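/- Conventions. For $d\ge 1$ let $\mathcal F_x f(\xi)=(2\pi)^{-d/2}\int_{\mathbb R^d} f(x)e^{-ix\cdot\xi}\,dx$ and $\mathcal F_{t,x}u(\tau,\xi)=(2\pi)^{-(d+1)/2}\iint u(t,x)e^{-ix\cdot\xi-it\tau}\,dx\,dt$. Fix a smooth even function $\eta:\mathbb R\to\mathbb R$, non-increasing on $[0,\infty)$, with $\mathbf 1_{[-4/3,4/3]}\le\eta\le\mathbf 1_{[-5/3,5/3]}$. Put $\eta_0=\eta$ and $\eta_j=\eta(\cdot/2^j)-\eta(\cdot/2^{j-1})$ for $j\ge1$. For $N\in 2^{\mathbb N_0}$ put $\psi_1(\xi)=\eta(|\xi|)$, $\psi_N(\xi)=\eta(|\xi|/N)-\eta(2|\xi|/N)$ for $N\ge2$, let $P_N$ be the Fourier multiplier with symbol $\psi_N$, and let $\mathcal I_1=\{|\xi|\le2\}$, $\mathcal I_N=\{N/2\le|\xi|\le2N\}$ for $N\ge2$. For $\sigma\ne0$ let $$\|f\|_{X_{N,\sigma}}=\sum_{j\ge0}2^{j/2}\|\eta_j(\tau+\sigma|\xi|^2)f(\tau,\xi)\|_{L^2_{\tau,\xi}}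 .$$ For $T\in(0,1]$ let $F_{N,\sigma,T}$ be the space of $u\in C(\mathbb R;L^2(\mathbb R^d;\mathbb C))$ vanishing for $t\notin[-4,4]$, with $\mathcal F_{t,x}u$ supported in $\mathbb R\times\mathcal I_N$ and $$\|u\|_{F_{N,\sigma,T}}=\sup_{t_N\in\mathbb R}\|\mathcal F_{t,x}[\eta_0(NT^{-1}(t-t_N))u]\|_{X_{N,\sigma}}<\infty .$$ Let $F_{N,\sigma}(T)$ be the space of $u\in C([0,T];L^2(\mathbb R^d))$ with $\|u\|_{F_{N,\sigma}(T)}=\inf\{\|\tilde u\|_{F_{N,\sigma,T}}:\tilde u\in F_{N,\sigma,T},\ \tilde u=u\text{ on }[0,T]\}<\infty$, and let $F^0_\sigma(T)$ be the space of $u\in C([0,T];L^2(\mathbb R^d))$ with $\sum_{N\in2^{\mathbb N_0}}\|P_Nu\|_{F_{N,\sigma}(T)}^2<\infty$. For $N_1,N_2,N_3\in2^{\mathbb N_0}$ write $N_1^*=\max(N_1,N_2,N_3)$, $N_3^*=\min(N_1,N_2,N_3)$ and $g_0=\mathbf 1_{[0,T/N_1^*]}$. Statement. Let $d\ge1$ and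 let $\alpha,\beta,\gamma\in\mathbb R\setminus\{0\}$ satisfy $\alpha-\gamma=0$ and $\beta+\gamma\neq0$. Let $s<\frac{d-1}2$ and $T\in(0,1]$. (1) For every $C>0$ there are $N_1,N_2,N_3\in2^{\mathbb N_0}$ and $u\in F_{N_1,\alpha}(T)$, $v\in F_{N_2,\beta}(T)$, $w\in F_{N_3,\gamma}(T)$ such that $$\Bigl|\int_{\mathbb R}\int_{\mathbb R^d}\overline{(g_0u)}\,(g_0v)\,(g_0w)\,dx\,dt\Bigr|>C\,(N_1^*)^{-1}(N_3^*)^{s}\,\|u\|_{F_{N_1,\alpha}(T)}\|v\|_{F_{N_2,\beta}(T)}\|w\|_{F_{N_3,\gamma}(T)} .$$ Moreover, if $d\ge2$ or $\alpha\ne\beta$, then $u,v,w$ can be chosen to be free Schrödinger solutions $u=e^{it\alpha\Delta}f_1$, $v=e^{it\beta\Delta}f_2$, $w=e^{it\gamma\Delta}f_3$ with $f_1,f_2,f_3\in L^2(\mathbb R^d)$. (2) Consequently the exponent $\frac{d-1}2$ of $N_3^*$ in the localized trilinear estimate cannot be lowered to $s$: there is no constant $A$ such that $$\Bigl|\int_{\mathbb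 R}\int_{\mathbb R^d}\overline{(g_0P_{N_1}u)}\,(g_0P_{N_2}v)\,(g_0P_{N_3}w)\,dx\,dt\Bigr|\le A\,(N_1^*)^{-1}(N_3^*)^{s}\,\|P_{N_1}u\|_{F_{N_1,\alpha}(T)}\|P_{N_2}v\|_{F_{N_2,\beta}(T)}\|P_{N_3}w\|_{F_{N_3,\gamma}(T)}$$ for all $N_1,N_2,N_3\in2^{\mathbb N_0}$, $u\in F^0_\alpha(T)$, $v\in F^0_\beta(T)$, $w\in F^0_\gamma(T)$. -/

import Mathlib

open MeasureTheory Set Filter FourierTransform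
open scoped ENNReal ContDiff

noncomputable section

/-- The Euclidean space `ℝ^d`. -/
abbrev RSpace (d : ℕ) : Type := EuclideanSpace ℝ (Fin d)

/-- The complex Hilbert space `L²(ℝ^d; ℂ)`. -/
abbrev L2Space (d : ℕ) : Type := Lp ℂ 2 (volume : Measure (RSpace d))

/-! ### The fixed cutoff and the dyadic partitions of unity -/

/-- A smooth even cutoff `η`, non-increasing on `[0, ∞)`, with
`1_{[-4/3, 4/3]} ≤ η ≤ 1_{[-5/3, 5/3]}` (so its support is compact). -/
structure Cutoff where
  /-- the underlying function -/
  toFun : ℝ → ℝ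
  smooth : ContDiff ℝ ∞ toFun
  even : ∀ x, toFun (-x) = toFun x
  antitone : AntitoneOn toFun (Ici 0)
  lower : ∀ x, (Icc (-(4 / 3 : ℝ)) (4 / 3)).indicator (fun _ => (1 : ℝ)) x ≤ toFun x
  upper : ∀ x, toFun x ≤ (Icc (-(5 / 3 : ℝ)) (5 / 3)).indicator (fun _ => (1 : ℝ)) x

/-- The modulation cutoffs: `η_0 = η` and `η_j = η(·/2^j) - η(·/2^{j-1})` for `j ≥ 1`. -/
def Cutoff.eta (η : Cutoff) (j : ℕ) (x : ℝ) : ℝ :=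
  if j = 0 then η.toFun x else η.toFun (x / 2 ^ j) - η.toFun (x / 2 ^ (j - 1))

/-- The spatial frequency cutoffs: `ψ_1(ξ) = η(|ξ|)` and
`ψ_N(ξ) = η(|ξ|/N) - η(2|ξ|/N)` for `N ≥ 2`. -/
def Cutoff.psi (η : Cutoff) {d : ℕ} (N : ℕ) (ξ : RSpace d) : ℝ :=
  if N = 1 then η.toFun ‖ξ‖ else η.toFun (‖ξ‖ / N) - η.toFun (2 * ‖ξ‖ / N)

/-- `N ∈ 2^{ℕ₀}`. -/
def IsDyadic (N : ℕ) : Prop := ∃ k : ℕ, N = 2 ^ k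

/-- The dyadic region `𝓘_N`: a ball for `N = 1`, an annulus for `N ≥ 2`. -/
def dyadicRegion (d N : ℕ) : Set (RSpace d) :=
  if N = 1 then {ξ | ‖ξ‖ ≤ 2} else {ξ | (N : ℝ) / 2 ≤ ‖ξ‖ ∧ ‖ξ‖ ≤ 2 * N}

theorem Cutoff.nonneg (η : Cutoff) (x : ℝ) : 0 ≤ η.toFun x :=
  le_trans (indicator_nonneg (fun _ _ => zero_le_one) x) (η.lower x)

theorem Cutoff.le_one (η : Cutoff) (x : ℝ) : η.toFun x ≤ 1 :=
  le_trans (η.upper x) (indicator_le_self' (fun _ _ => zero_le_one) x)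

theorem Cutoff.measurable_psi (η : Cutoff) {d : ℕ} (N : ℕ) :
    Measurable (fun ξ : RSpace d => ((η.psi N ξ : ℝ) : ℂ)) := by
  have h : Continuous η.toFun := η.smooth.continuous
  unfold Cutoff.psi
  split_ifs
  · exact (Complex.continuous_ofReal.comp (h.comp continuous_norm)).measurable
  · refine (Complex.continuous_ofReal.comp ((h.comp ?_).sub (h.comp ?_))).measurable
    · exact continuous_norm.div_const _
    · exact (continuous_const.mul continuous_norm).div_const _

theorem Cutoff.norm_psi_le (η : Cutoff) {d : ℕ} (N : ℕ) (ξ : RSpace d) :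
    ‖((η.psi N ξ : ℝ) : ℂ)‖ ≤ 1 := by
  rw [Complex.norm_real, Real.norm_eq_abs, abs_le]
  unfold Cutoff.psi
  have h1 := η.nonneg ‖ξ‖
  have h2 := η.le_one ‖ξ‖
  have h3 := η.nonneg (‖ξ‖ / N)
  have h4 := η.le_one (‖ξ‖ / N)
  have h5 := η.nonneg (2 * ‖ξ‖ / N)
  have h6 := η.le_one (2 * ‖ξ‖ / N)
  split_ifs <;> constructor <;> linarith

/-! ### Fourier transforms -/

/-- The spatial Fourier transform `(2π)^{-d/2} ∫ f(x) e^{-i x·ξ} dx` on `L²(ℝ^d)`, obtained by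
rescaling Mathlib's Fourier transform `𝓕` on `L²` (whose kernel is `e^{-2πi x·ξ}`). -/
def spaceFourier {d : ℕ} (f : L2Space d) (ξ : RSpace d) : ℂ :=
  (((2 * Real.pi) ^ (-(d : ℝ) / 2) : ℝ) : ℂ) * (𝓕 f : L2Space d) ((2 * Real.pi)⁻¹ • ξ)

/-- The Fourier transform in time of an `L²(ℝ^d)`-valued function,
`(2π)^{-1/2} ∫ e^{-i t τ} u(t) dt` (a Bochner integral). -/
def timeFourier {d : ℕ} (u : ℝ → L2Space d) (τ : ℝ) : L2Space d :=
  (((2 * Real.pi) ^ (-(1 : ℝ) / 2) : ℝ) : ℂ) •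
    ∫ t : ℝ, Complex.exp (-Complex.I * ((t * τ : ℝ) : ℂ)) • u t

/-- The space-time Fourier transform of `u`, as a function of `(τ, ξ)`. -/
def spaceTimeFourier {d : ℕ} (u : ℝ → L2Space d) (τ : ℝ) (ξ : RSpace d) : ℂ :=
  spaceFourier (timeFourier u τ) ξ

theorem memLp_multiplier {d : ℕ} (m : RSpace d → ℂ) (hm : Measurable m)
    (hb : ∀ ξ, ‖m ξ‖ ≤ 1) (f : L2Space d) :
    MemLp (fun ξ => m ((2 * Real.pi) • ξ) * (𝓕 f : L2Space d) ξ) 2 volume := by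
  have hf := Lp.memLp (𝓕 f : L2Space d)
  refine hf.of_le ?_ (Eventually.of_forall fun ξ => ?_)
  · exact (hm.comp (measurable_const_smul _)).aestronglyMeasurable.mul hf.aestronglyMeasurable
  · rw [norm_mul]
    exact mul_le_of_le_one_left (norm_nonneg _) (hb _)

/-- The Fourier multiplier on `L²(ℝ^d)` with a bounded symbol `m(ξ)`, `ξ` being the frequency
variable of `spaceFourier` (that is, `2π` times that of `𝓕`). -/
def fourierMultiplier {d : ℕ} (m : RSpace d → ℂ) (hm : Measurable m)
    (hb : ∀ ξ, ‖m ξ‖ ≤ 1) (f : L2Space d) : L2Space d :=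
  𝓕⁻ ((memLp_multiplier m hm hb f).toLp _)

/-- The Littlewood-Paley operator `P_N`, with symbol `ψ_N`. -/
def Cutoff.proj (η : Cutoff) {d : ℕ} (N : ℕ) (f : L2Space d) : L2Space d :=
  fourierMultiplier (fun ξ => ((η.psi N ξ : ℝ) : ℂ)) (η.measurable_psi N) (η.norm_psi_le N) f

theorem measurable_schrodingerSymbol {d : ℕ} (σ t : ℝ) :
    Measurable (fun ξ : RSpace d =>
      Complex.exp (((-(σ * t * ‖ξ‖ ^ 2) : ℝ) : ℂ) * Complex.I)) := by
  refine Continuous.measurable ?_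
  fun_prop

/-- The free Schrödinger evolution `e^{i t σ Δ} f`, with symbol `e^{-i t σ |ξ|²}`. -/
def freeSchrodinger {d : ℕ} (σ : ℝ) (f : L2Space d) (t : ℝ) : L2Space d :=
  fourierMultiplier
    (fun ξ => Complex.exp (((-(σ * t * ‖ξ‖ ^ 2) : ℝ) : ℂ) * Complex.I))
    (measurable_schrodingerSymbol σ t)
    (fun _ => (Complex.norm_exp_ofReal_mul_I _).le) f

/-! ### The short-time function spaces -/

/-- The norm `∑_j 2^{j/2} ‖η_j(τ + σ|ξ|²) F(τ, ξ)‖_{L²_{τ,ξ}}` of `X_{N,σ}`, with values in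
`[0, ∞]`. -/
def Cutoff.normX (η : Cutoff) {d : ℕ} (σ : ℝ) (F : ℝ → RSpace d → ℂ) : ℝ≥0∞ :=
  ∑' j : ℕ, ENNReal.ofReal (2 ^ ((j : ℝ) / 2)) *
    (∫⁻ τ : ℝ, ∫⁻ ξ : RSpace d,
      ‖((η.eta j (τ + σ * ‖ξ‖ ^ 2) : ℝ) : ℂ) * F τ ξ‖ₑ ^ 2) ^ (1 / 2 : ℝ)

/-- The norm `sup_{t_N ∈ ℝ} ‖F_{t,x}[η_0(N T⁻¹ (t - t_N)) u]‖_{X_{N,σ}}` of `F_{N,σ,T}`. -/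
def Cutoff.normFGlobal (η : Cutoff) {d : ℕ} (N : ℕ) (σ T : ℝ) (u : ℝ → L2Space d) : ℝ≥0∞ :=
  ⨆ tN : ℝ, η.normX σ
    (spaceTimeFourier fun t => ((η.eta 0 (N * T⁻¹ * (t - tN)) : ℝ) : ℂ) • u t)

/-- The space `F_{N,σ,T}`: continuous functions `u : ℝ → L²(ℝ^d)` vanishing outside `[-4, 4]`,
with space-time Fourier transform supported in `ℝ × 𝓘_N` and finite norm. -/
structure Cutoff.MemFGlobal (η : Cutoff) {d : ℕ} (N : ℕ) (σ T : ℝ) (u : ℝ → L2Space d) :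
    Prop where
  continuous : Continuous u
  vanish : ∀ t, t ∉ Icc (-4 : ℝ) 4 → u t = 0
  supported : ∀ τ, ∀ᵐ ξ : RSpace d, ξ ∉ dyadicRegion d N → spaceTimeFourier u τ ξ = 0
  finite : η.normFGlobal N σ T u < ⊤

/-- The norm of `F_{N,σ}(T)`: the infimum of `‖ũ‖_{F_{N,σ,T}}` over the extensions
`ũ ∈ F_{N,σ,T}` of `u|_{[0,T]}` (it is `∞` if there is none). -/
def Cutoff.normF (η : Cutoff) {d : ℕ} (N : ℕ) (σ T : ℝ) (u : ℝ → L2Space d) : ℝ≥0∞ :=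
  ⨅ (v : ℝ → L2Space d) (_ : η.MemFGlobal N σ T v ∧ EqOn v u (Icc 0 T)), η.normFGlobal N σ T v

/-- The space `F_{N,σ}(T)`. A function in `C([0,T]; L²)` is represented by a function on `ℝ`,
whose values outside `[0, T]` are irrelevant. -/
def Cutoff.MemF (η : Cutoff) {d : ℕ} (N : ℕ) (σ T : ℝ) (u : ℝ → L2Space d) : Prop :=
  ContinuousOn u (Icc 0 T) ∧ η.normF N σ T u < ⊤

/-- The space `F^0_σ(T)`: functions in `C([0,T]; L²)` such that the dyadic sequence
`‖P_N u‖_{F_{N,σ}(T)}` is square summable. -/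
def Cutoff.MemFZero (η : Cutoff) {d : ℕ} (σ T : ℝ) (u : ℝ → L2Space d) : Prop :=
  ContinuousOn u (Icc 0 T) ∧
    ∑' k : ℕ, (η.normF (2 ^ k) σ T fun t => η.proj (2 ^ k) (u t)) ^ 2 < ⊤

/-! ### The localized trilinear integral -/

/-- The indicator function of `[0, T/N]`. -/
def timeWindow (T : ℝ) (N : ℕ) : ℝ → ℂ := (Icc 0 (T / N)).indicator 1

/-- The modulus of `∫_ℝ ∫_{ℝ^d} conj(g u) (g v) (g w) dx dt`, where `g = 1_{[0, T/N]}`. -/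
def trilinearIntegral {d : ℕ} (T : ℝ) (N : ℕ) (u v w : ℝ → L2Space d) : ℝ :=
  ‖∫ t : ℝ, ∫ x : RSpace d,
    (starRingEnd ℂ) (timeWindow T N t * u t x) * (timeWindow T N t * v t x) *
      (timeWindow T N t * w t x)‖

end

open MeasureTheory Set Filter FourierTransform
open scoped ENNReal ContDiff

noncomputable section

theorem integral_fourierInv_mul_eq {d : ℕ} {f g : RSpace d → ℂ} (hf : Integrable f)
    (hg : Integrable g) :
    ∫ x, 𝓕⁻ f x * g x = ∫ x, f x * 𝓕⁻ g x := by
  have h := VectorFourier.integral_fourierIntegral_smul_eq_flip (μ := volume) (ν := volume)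
    (L := -innerₗ (RSpace d)) (e := Real.fourierChar) (f := f) (g := g)
    Real.continuous_fourierChar (continuous_inner (𝕜 := ℝ) (E := RSpace d)).neg hf hg
  have e : ∀ (k : RSpace d → ℂ) x, 𝓕⁻ k x = ∫ v, Real.fourierChar (inner ℝ v x) • k v :=
    fun k x => Real.fourierInv_eq k x
  simp only [VectorFourier.fourierIntegral, smul_eq_mul, LinearMap.neg_apply, neg_neg,
    LinearMap.flip_apply, innerₗ_apply_apply] at h
  simp only [e, h]
  congr 1; ext x; congr 2; ext v
  rw [real_inner_comm]

theorem continuous_fourierInv {d : ℕ} {f : RSpace d → ℂ} (hf : Integrable f) :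
    Continuous (𝓕⁻ f) := by
  have h := VectorFourier.fourierIntegral_continuous (μ := volume)
    (L := -innerₗ (RSpace d)) (e := Real.fourierChar) (f := f)
    Real.continuous_fourierChar (continuous_inner (𝕜 := ℝ) (E := RSpace d)).neg hf
  have e : 𝓕⁻ f = VectorFourier.fourierIntegral Real.fourierChar volume (-innerₗ (RSpace d)) f := by
    funext w
    simp [VectorFourier.fourierIntegral, Real.fourierInv_eq]
  rw [e]; exact h

/-- The inverse Fourier transform on `L²` is given by the Fourier integral on `L¹ ∩ L²`. -/
theorem fourierInv_toLp_ae_eq {d : ℕ} {f : RSpace d → ℂ} (h1 : Integrable f)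
    (h2 : MemLp f 2 volume) :
    ((𝓕⁻ (h2.toLp f) : L2Space d) : RSpace d → ℂ) =ᵐ[volume] 𝓕⁻ f := by
  refine ae_eq_of_integral_contDiff_smul_eq ?_ ?_ ?_
  · exact (Lp.memLp _).locallyIntegrable (by norm_num)
  · exact (continuous_fourierInv h1).locallyIntegrable
  intro g hg hgc
  have hc : HasCompactSupport (fun x => ((g x : ℝ) : ℂ)) :=
    hgc.comp_left (g := fun x : ℝ => (x : ℂ)) (by simp)
  have hd : ContDiff ℝ ∞ (fun x => ((g x : ℝ) : ℂ)) := Complex.ofRealCLM.contDiff.comp hg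
  set φ : SchwartzMap (RSpace d) ℂ := hc.toSchwartzMap hd
  have hφ : ∀ x, φ x = (g x : ℂ) := fun x => rfl
  have h := congrArg (fun D => D φ) (Lp.fourierInv_toTemperedDistribution_eq (h2.toLp f))
  simp only [TemperedDistribution.fourierInv_apply, Lp.toTemperedDistribution_apply] at h
  have e1 : ∀ x (z : ℂ), g x • z = φ x • z := by
    intro x z; simp [hφ]
  simp only [e1]
  rw [← h]
  have e2 : ∫ x, (𝓕⁻ φ) x • (h2.toLp f : L2Space d) x = ∫ x, (𝓕⁻ φ) x • f x := by
    refine integral_congr_ae ?_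
    filter_upwards [h2.coeFn_toLp] with x hx
    rw [hx]
  rw [e2]
  simpa [SchwartzMap.fourierInv_coe] using! integral_fourierInv_mul_eq φ.integrable h1

theorem fourierInv_comp_sub {d : ℕ} (f : RSpace d → ℂ) (ζ x : RSpace d) :
    𝓕⁻ (fun y => f (y - ζ)) x = Real.fourierChar (inner ℝ x ζ) • 𝓕⁻ f x := by
  simp only [Real.fourierInv_eq]
  rw [← integral_add_right_eq_self _ ζ, Circle.smul_def, ← integral_smul]
  congr 1; ext v
  rw [← Circle.smul_def]
  rw [smul_smul, ← AddChar.map_add_eq_mul]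
  simp [inner_add_left, real_inner_comm, add_comm]

/-- The trilinear form `∫ conj(u) v w` in terms of the Fourier transforms. -/
theorem integral_conj_mul_mul_fourierInv {d : ℕ} {f₁ f₂ f₃ : RSpace d → ℂ}
    (h₁ : MemLp f₁ 2 volume) (h₂ : MemLp f₂ 2 volume) (h₃ : MemLp f₃ 2 volume)
    (i₂ : Integrable f₂) (i₃ : Integrable f₃) :
    ∫ x, (starRingEnd ℂ) ((𝓕⁻ (h₁.toLp f₁) : L2Space d) x) * (𝓕⁻ (h₂.toLp f₂) : L2Space d) x *
        (𝓕⁻ (h₃.toLp f₃) : L2Space d) x =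
      ∫ ζ, f₂ ζ * ∫ y, (starRingEnd ℂ) (f₁ y) * f₃ (y - ζ) := by
  set U₁ : L2Space d := 𝓕⁻ (h₁.toLp f₁)
  set U₃ : L2Space d := 𝓕⁻ (h₃.toLp f₃)
  set G : RSpace d → ℂ := fun x => (starRingEnd ℂ) (U₁ x) * U₃ x
  have hG : Integrable G := by
    have := L2.integrable_inner (𝕜 := ℂ) U₁ U₃
    exact this.congr (Eventually.of_forall fun x => by
      simp only [G, RCLike.inner_apply]; rw [mul_comm])
  calc _ = ∫ x, G x * 𝓕⁻ f₂ x := by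
        refine integral_congr_ae ?_
        filter_upwards [fourierInv_toLp_ae_eq i₂ h₂] with x hx
        rw [hx]; ring
    _ = ∫ ζ, 𝓕⁻ G ζ * f₂ ζ := (integral_fourierInv_mul_eq hG i₂).symm
    _ = _ := by
        congr 1; ext ζ
        rw [mul_comm]; congr 1
        have h₃' : MemLp (fun y => f₃ (y - ζ)) 2 volume :=
          h₃.comp_measurePreserving (measurePreserving_sub_right volume ζ)
        have i₃' : Integrable (fun y => f₃ (y - ζ)) := i₃.comp_sub_right ζ
        have e1 : 𝓕⁻ G ζ = inner ℂ U₁ (𝓕⁻ (h₃'.toLp _) : L2Space d) := by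
          rw [L2.inner_def, Real.fourierInv_eq]
          refine integral_congr_ae ?_
          filter_upwards [fourierInv_toLp_ae_eq i₃' h₃', fourierInv_toLp_ae_eq i₃ h₃]
            with x hx hx3
          rw [hx, fourierInv_comp_sub, ← hx3]
          simp only [G, RCLike.inner_apply, Circle.smul_def, smul_eq_mul, U₃]
          ring
        have e2 : inner ℂ U₁ (𝓕⁻ (h₃'.toLp _) : L2Space d) =
            inner ℂ (h₁.toLp f₁) (h₃'.toLp _) :=
          (Lp.fourierTransformₗᵢ (RSpace d) ℂ).symm.inner_map_map _ _
        rw [e1, e2, L2.inner_def]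
        refine integral_congr_ae ?_
        filter_upwards [h₁.coeFn_toLp, h₃'.coeFn_toLp] with x hx hx3
        rw [hx, hx3]
        simp only [RCLike.inner_apply]; rw [mul_comm]

open TopologicalSpace (Compacts)

variable {d : ℕ}

/-- An `L²`-valued Bochner integral is computed pointwise. -/
theorem coeFn_integral_ae_eq {F : ℝ → L2Space d} {K : ℝ → RSpace d → ℂ} (hF : Integrable F)
    (hFK : ∀ t, F t =ᵐ[volume] K t)
    (hK : Integrable (Function.uncurry K) (volume.prod volume)) :
    ((∫ t, F t : L2Space d) : RSpace d → ℂ) =ᵐ[volume] fun ξ => ∫ t, K t ξ := by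
  refine ae_eq_of_forall_setIntegral_eq_of_sigmaFinite ?_ ?_ ?_
  · intro E hE hμ
    have : IsFiniteMeasure (volume.restrict E) := ⟨by simpa using hμ⟩
    exact ((Lp.memLp (∫ t, F t : L2Space d)).restrict E).integrable (by norm_num)
  · intro E hE hμ
    exact (Integrable.integral_prod_right hK).integrableOn
  · intro E hE hμ
    have h := fun f : L2Space d => L2.inner_indicatorConstLp_one (𝕜 := ℂ) hE hμ.ne f
    rw [← h, ← integral_inner hF]
    simp_rw [h]
    have e : ∀ t, ∫ x in E, F t x = ∫ x in E, K t x := fun t =>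
      integral_congr_ae (ae_restrict_of_ae (hFK t))
    simp_rw [e]
    refine integral_integral_swap (f := K) (ν := volume.restrict E) ?_
    have := hK.integrableOn (s := univ ×ˢ E)
    rwa [IntegrableOn, ← Measure.prod_restrict, Measure.restrict_univ] at this

theorem memLp_indicator_smul (p : ℝ≥0∞) (m : C(RSpace d, ℂ)) (S : Compacts (RSpace d)) :
    MemLp (fun ζ => (S : Set (RSpace d)).indicator m ((2 * Real.pi) • ζ)) p volume := by
  have hc : (2 * Real.pi) ≠ 0 := by positivity
  set K := (fun ζ : RSpace d => (2 * Real.pi) • ζ) ⁻¹' S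
  have hK : IsCompact K :=
    (Homeomorph.smulOfNeZero _ hc).isCompact_preimage.2 S.isCompact
  have e : (fun ζ => (S : Set (RSpace d)).indicator m ((2 * Real.pi) • ζ)) =
      K.indicator (fun ζ => m ((2 * Real.pi) • ζ)) := by
    rfl
  have hcont : Continuous (fun ζ : RSpace d => m ((2 * Real.pi) • ζ)) := by fun_prop
  rw [e, memLp_indicator_iff_restrict hK.measurableSet]
  obtain ⟨C, hC⟩ := hK.exists_bound_of_continuousOn hcont.continuousOn
  have : IsFiniteMeasure (volume.restrict K) := ⟨by simpa using hK.measure_lt_top⟩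
  exact MemLp.of_bound hcont.aestronglyMeasurable C
    ((ae_restrict_iff' hK.measurableSet).2 (Eventually.of_forall hC))

/-- The `L²` function whose `spaceFourier` is, up to normalisation, `1_S m`. -/
def packet (m : C(RSpace d, ℂ)) (S : Compacts (RSpace d)) : L2Space d :=
  𝓕⁻ ((memLp_indicator_smul 2 m S).toLp _)

theorem fourier_packet (m : C(RSpace d, ℂ)) (S : Compacts (RSpace d)) :
    𝓕 (packet m S) = (memLp_indicator_smul 2 m S).toLp _ :=
  fourier_fourierInv_eq _

theorem fourier_packet_ae (m : C(RSpace d, ℂ)) (S : Compacts (RSpace d)) :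
    (𝓕 (packet m S) : L2Space d) =ᵐ[volume]
      fun ζ => (S : Set (RSpace d)).indicator m ((2 * Real.pi) • ζ) := by
  rw [fourier_packet]; exact MemLp.coeFn_toLp _

theorem fourierMultiplier_packet {k : RSpace d → ℂ} (hm : Measurable k) (hb : ∀ ξ, ‖k ξ‖ ≤ 1)
    (m m' : C(RSpace d, ℂ)) (S : Compacts (RSpace d)) (h : ∀ ξ ∈ S, k ξ * m ξ = m' ξ) :
    fourierMultiplier k hm hb (packet m S) = packet m' S := by
  unfold fourierMultiplier
  conv_rhs => unfold packet
  congr 1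
  rw [MemLp.toLp_eq_toLp_iff]
  filter_upwards [fourier_packet_ae m S] with ζ hζ
  rw [hζ]
  by_cases hS : (2 * Real.pi) • ζ ∈ (S : Set (RSpace d))
  · simp [hS, h _ hS]
  · simp [hS]

theorem packet_zero (S : Compacts (RSpace d)) : packet (0 : C(RSpace d, ℂ)) S = 0 := by
  have h : 𝓕 (packet (0 : C(RSpace d, ℂ)) S) = 0 := by
    rw [Lp.eq_zero_iff_ae_eq_zero]
    filter_upwards [fourier_packet_ae 0 S] with ζ hζ
    rw [hζ]
    simp [indicator]
  exact (Lp.fourierTransformₗᵢ (RSpace d) ℂ).map_eq_zero_iff.1 h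

theorem norm_packet_sub_le {m₁ m₂ m₃ : C(RSpace d, ℂ)} (S : Compacts (RSpace d)) {c : ℝ}
    (h : ∀ ξ ∈ S, ‖m₁ ξ - m₂ ξ‖ ≤ c * ‖m₃ ξ‖) :
    ‖packet m₁ S - packet m₂ S‖ ≤ c * ‖packet m₃ S‖ := by
  have e : ∀ f : L2Space d, ‖𝓕 f‖ = ‖f‖ := Lp.norm_fourier_eq
  have e2 : 𝓕 (packet m₁ S - packet m₂ S) = 𝓕 (packet m₁ S) - 𝓕 (packet m₂ S) :=
    (Lp.fourierTransformₗᵢ (RSpace d) ℂ).map_sub _ _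
  rw [← e (_ - _), ← e (packet m₃ S), e2]
  refine Lp.norm_le_mul_norm_of_ae_le_mul ?_
  filter_upwards [Lp.coeFn_sub (𝓕 (packet m₁ S) : L2Space d) (𝓕 (packet m₂ S)),
    fourier_packet_ae m₁ S, fourier_packet_ae m₂ S, fourier_packet_ae m₃ S] with ζ h0 h1 h2 h3
  rw [h0, Pi.sub_apply, h1, h2, h3]
  by_cases hS : (2 * Real.pi) • ζ ∈ (S : Set (RSpace d))
  · simpa [hS] using h _ hS
  · simp [hS]

/-- The oscillating symbol `e^{-i t p(ξ)}`. -/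
def phaseFactor (p : C(RSpace d, ℝ)) (t : ℝ) : C(RSpace d, ℂ) :=
  ⟨fun ξ => Complex.exp (((-(t * p ξ) : ℝ) : ℂ) * Complex.I), by fun_prop⟩

@[simp] theorem norm_phaseFactor (p : C(RSpace d, ℝ)) (t : ℝ) (ξ : RSpace d) :
    ‖phaseFactor p t ξ‖ = 1 := Complex.norm_exp_ofReal_mul_I _

theorem norm_phaseFactor_sub_le (p : C(RSpace d, ℝ)) (t t' : ℝ) (ξ : RSpace d) :
    ‖phaseFactor p t ξ - phaseFactor p t' ξ‖ ≤ |t - t'| * |p ξ| := by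
  have e : phaseFactor p t ξ - phaseFactor p t' ξ = phaseFactor p t' ξ *
      (Complex.exp (Complex.I * ((-((t - t') * p ξ) : ℝ) : ℂ)) - 1) := by
    simp only [phaseFactor, ContinuousMap.coe_mk, mul_sub, ← Complex.exp_add, mul_one]
    congr 2; push_cast; ring
  rw [e, norm_mul, norm_phaseFactor, one_mul]
  refine (Real.norm_exp_I_mul_ofReal_sub_one_le).trans ?_
  rw [Real.norm_eq_abs, abs_neg, abs_mul]

/-- The wave with dispersion relation `p` and initial frequency profile `1_S`. -/
def wave (p : C(RSpace d, ℝ)) (S : Compacts (RSpace d)) (t : ℝ) : L2Space d :=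
  packet (phaseFactor p t) S

theorem continuous_wave (p : C(RSpace d, ℝ)) (S : Compacts (RSpace d)) :
    Continuous (wave p S) := by
  set P : C(RSpace d, ℂ) := ⟨fun ξ => (p ξ : ℂ), by fun_prop⟩
  have : LipschitzWith ‖packet P S‖₊ (wave p S) := by
    refine LipschitzWith.of_dist_le_mul fun t t' => ?_
    rw [dist_eq_norm, dist_eq_norm, mul_comm]
    refine norm_packet_sub_le S fun ξ _ => ?_
    simpa [P] using norm_phaseFactor_sub_le p t t' ξ
  exact this.continuous

theorem fourier_smul_wave_ae (p : C(RSpace d, ℝ)) (S : Compacts (RSpace d)) (c : ℂ) (t : ℝ) :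
    (𝓕 (c • wave p S t) : L2Space d) =ᵐ[volume]
      fun ζ => (S : Set (RSpace d)).indicator (fun ξ => c * phaseFactor p t ξ)
        ((2 * Real.pi) • ζ) := by
  have e : 𝓕 (c • wave p S t) = c • 𝓕 (wave p S t) :=
    (Lp.fourierTransformₗᵢ (RSpace d) ℂ).map_smul _ _
  rw [e]
  filter_upwards [Lp.coeFn_smul c (𝓕 (wave p S t) : L2Space d),
    fourier_packet_ae (phaseFactor p t) S] with ζ h0 h1
  rw [h0, Pi.smul_apply, wave, h1]
  by_cases hS : (2 * Real.pi) • ζ ∈ (S : Set (RSpace d)) <;> simp [hS]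

/-- The Fourier transform `(2π)^{-1/2} ∫ g(t) e^{-itτ} dt` of a scalar function of time. -/
def scalarFourier (g : ℝ → ℝ) (τ : ℝ) : ℂ :=
  (((2 * Real.pi) ^ (-(1 : ℝ) / 2) : ℝ) : ℂ) *
    ∫ t : ℝ, Complex.exp (-Complex.I * ((t * τ : ℝ) : ℂ)) * (g t : ℂ)

theorem ae_smul_two_pi {P : RSpace d → Prop} (h : ∀ᵐ ζ, P ((2 * Real.pi) • ζ)) :
    ∀ᵐ ξ : RSpace d, P ξ := by
  have hc : (2 * Real.pi) ≠ 0 := by positivity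
  have hq : Measure.QuasiMeasurePreserving (fun ξ : RSpace d => (2 * Real.pi)⁻¹ • ξ)
      volume volume := by
    refine ⟨measurable_const_smul _, ?_⟩
    rw [Measure.map_addHaar_smul _ (inv_ne_zero hc)]
    exact Measure.smul_absolutelyContinuous
  filter_upwards [hq.ae h] with ξ hξ
  rwa [smul_inv_smul₀ hc] at hξ

/-- The space-time Fourier transform of a wave with a time cutoff. -/
theorem spaceTimeFourier_smul_wave (p : C(RSpace d, ℝ)) (S : Compacts (RSpace d)) {g : ℝ → ℝ}
    (hg : Continuous g) (hgc : HasCompactSupport g) (τ : ℝ) :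
    ∀ᵐ ξ : RSpace d, spaceTimeFourier (fun t => (g t : ℂ) • wave p S t) τ ξ =
      (((2 * Real.pi) ^ (-(d : ℝ) / 2) : ℝ) : ℂ) *
        (S : Set (RSpace d)).indicator (fun ξ => scalarFourier g (τ + p ξ)) ξ := by
  have hc : (2 * Real.pi) ≠ 0 := by positivity
  set k : ℝ → ℂ := fun t => Complex.exp (-Complex.I * ((t * τ : ℝ) : ℂ)) * (g t : ℂ)
  have hk : Continuous k := by fun_prop
  have hkc : HasCompactSupport k :=
    HasCompactSupport.mul_left (hgc.comp_left (g := fun x : ℝ => (x : ℂ)) (by simp))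
  set F : ℝ → L2Space d := fun t => k t • wave p S t
  have hF : Integrable F :=
    (hk.smul (continuous_wave p S)).integrable_of_hasCompactSupport hkc.smul_right
  have e1 : 𝓕 (timeFourier (fun t => (g t : ℂ) • wave p S t) τ) =
      (((2 * Real.pi) ^ (-(1 : ℝ) / 2) : ℝ) : ℂ) • ∫ t, 𝓕 (F t) := by
    have h1 : 𝓕 (∫ t, F t) = ∫ t, 𝓕 (F t) :=
      ((Lp.fourierTransformₗᵢ (RSpace d) ℂ).toContinuousLinearEquiv.toContinuousLinearMap
        |>.integral_comp_comm hF).symm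
    rw [← h1]
    simp only [timeFourier, smul_smul]
    exact (Lp.fourierTransformₗᵢ (RSpace d) ℂ).map_smul _ _
  have hF' : Integrable (fun t => (𝓕 (F t) : L2Space d)) :=
    (Lp.fourierTransformₗᵢ (RSpace d) ℂ).toContinuousLinearEquiv.toContinuousLinearMap
      |>.integrable_comp hF
  set K : ℝ → RSpace d → ℂ := fun t ζ =>
    (S : Set (RSpace d)).indicator (fun ξ => k t * phaseFactor p t ξ) ((2 * Real.pi) • ζ)
  have hK : Integrable (Function.uncurry K) (volume.prod volume) := by
    have h1 : Integrable (fun x : ℝ × RSpace d => k x.1 *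
        (S : Set (RSpace d)).indicator (1 : C(RSpace d, ℂ)) ((2 * Real.pi) • x.2))
        (volume.prod volume) :=
      (hk.integrable_of_hasCompactSupport hkc).mul_prod
        (memLp_one_iff_integrable.1 (memLp_indicator_smul 1 1 S))
    have h2 := h1.bdd_mul (c := 1) (f := fun x : ℝ × RSpace d =>
        phaseFactor p x.1 ((2 * Real.pi) • x.2))
      (by
        refine Continuous.aestronglyMeasurable ?_
        simp only [phaseFactor, ContinuousMap.coe_mk]; fun_prop)
      (Eventually.of_forall fun x => by simp)
    refine h2.congr (Eventually.of_forall fun x => ?_)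
    simp only [Function.uncurry, K]
    by_cases hS : (2 * Real.pi) • x.2 ∈ (S : Set (RSpace d))
    · simp only [hS, indicator_of_mem, ContinuousMap.one_apply, mul_one]; ring
    · simp [hS]
  have h := coeFn_integral_ae_eq hF' (fun t => fourier_smul_wave_ae p S (k t) t) hK
  unfold spaceTimeFourier spaceFourier
  rw [e1]
  refine ae_smul_two_pi ?_
  filter_upwards [h, Lp.coeFn_smul (((2 * Real.pi) ^ (-(1 : ℝ) / 2) : ℝ) : ℂ)
    (∫ t, 𝓕 (F t) : L2Space d)] with ζ h0 h1
  rw [inv_smul_smul₀ hc, h1, Pi.smul_apply, h0]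
  congr 1
  by_cases hS : (2 * Real.pi) • ζ ∈ (S : Set (RSpace d))
  · simp only [hS, indicator_of_mem, scalarFourier, smul_eq_mul]
    congr 1
    refine integral_congr_ae (Eventually.of_forall fun t => ?_)
    simp only [k, phaseFactor, ContinuousMap.coe_mk]
    rw [mul_right_comm, ← Complex.exp_add]
    congr 2; push_cast; ring
  · simp [hS]

/-! ### Plancherel in time -/

theorem scalarFourier_eq_fourier (g : ℝ → ℝ) (τ : ℝ) :
    scalarFourier g τ = (((2 * Real.pi) ^ (-(1 : ℝ) / 2) : ℝ) : ℂ) *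
      𝓕 (fun t => (g t : ℂ)) ((2 * Real.pi)⁻¹ * τ) := by
  have hc : (Real.pi : ℂ) ≠ 0 := by exact_mod_cast Real.pi_ne_zero
  rw [scalarFourier, Real.fourier_real_eq_integral_exp_smul]
  congr 1
  refine integral_congr_ae (Eventually.of_forall fun t => ?_)
  simp only [smul_eq_mul]
  congr 2
  push_cast
  field_simp

theorem continuous_scalarFourier {g : ℝ → ℝ} (hg : ContDiff ℝ ∞ g) (hgc : HasCompactSupport g) :
    Continuous (scalarFourier g) := by
  have hc : HasCompactSupport (fun x => ((g x : ℝ) : ℂ)) :=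
    hgc.comp_left (g := fun x : ℝ => (x : ℂ)) (by simp)
  have hd : ContDiff ℝ ∞ (fun x => ((g x : ℝ) : ℂ)) := Complex.ofRealCLM.contDiff.comp hg
  have e : scalarFourier g = fun τ => (((2 * Real.pi) ^ (-(1 : ℝ) / 2) : ℝ) : ℂ) *
      (𝓕 (hc.toSchwartzMap hd)) ((2 * Real.pi)⁻¹ * τ) :=
    funext fun τ => scalarFourier_eq_fourier g τ
  rw [e]
  fun_prop

theorem lintegral_scalarFourier_sq {g : ℝ → ℝ} (hg : ContDiff ℝ ∞ g)
    (hgc : HasCompactSupport g) :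
    ∫⁻ τ, ‖scalarFourier g τ‖ₑ ^ 2 = ENNReal.ofReal (∫ t, g t ^ 2) := by
  have hπ : (0 : ℝ) < 2 * Real.pi := by positivity
  have hc : HasCompactSupport (fun x => ((g x : ℝ) : ℂ)) :=
    hgc.comp_left (g := fun x : ℝ => (x : ℂ)) (by simp)
  have hd : ContDiff ℝ ∞ (fun x => ((g x : ℝ) : ℂ)) := Complex.ofRealCLM.contDiff.comp hg
  set φ : SchwartzMap ℝ ℂ := hc.toSchwartzMap hd
  have e : ∀ τ, ‖scalarFourier g τ‖ ^ 2 =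
      (2 * Real.pi)⁻¹ * ‖(𝓕 φ) ((2 * Real.pi)⁻¹ * τ)‖ ^ 2 := by
    intro τ
    have h1 : scalarFourier g τ = (((2 * Real.pi) ^ (-(1 : ℝ) / 2) : ℝ) : ℂ) *
      (𝓕 φ) ((2 * Real.pi)⁻¹ * τ) := scalarFourier_eq_fourier g τ
    rw [h1, norm_mul, mul_pow, Complex.norm_real, Real.norm_of_nonneg (by positivity),
      ← Real.rpow_natCast, ← Real.rpow_mul hπ.le]
    norm_num [Real.rpow_neg_one]
  have hint : Integrable (fun x => ‖(𝓕 φ) x‖ ^ 2) := by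
    have := ((𝓕 φ).memLp 2 volume).integrable_norm_pow (by norm_num)
    simpa using this
  have hint' : Integrable (fun τ => ‖scalarFourier g τ‖ ^ 2) := by
    simp_rw [e]
    exact (hint.comp_mul_left' (inv_ne_zero hπ.ne')).const_mul _
  have h1 : ∫ τ, ‖scalarFourier g τ‖ ^ 2 = ∫ t, g t ^ 2 := by
    simp_rw [e]
    rw [integral_const_mul, Measure.integral_comp_mul_left (fun x : ℝ => ‖(𝓕 φ : SchwartzMap ℝ ℂ) x‖ ^ 2), inv_inv,
      abs_of_pos hπ, smul_eq_mul, inv_mul_cancel_left₀ hπ.ne',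
      SchwartzMap.integral_norm_sq_fourier]
    refine integral_congr_ae (Eventually.of_forall fun t => ?_)
    have : φ t = (g t : ℂ) := rfl
    simp [this]
  rw [← h1, ofReal_integral_eq_lintegral_ofReal hint' (Eventually.of_forall fun _ => by positivity)]
  refine lintegral_congr fun τ => ?_
  rw [ENNReal.ofReal_pow (norm_nonneg _), ofReal_norm]

theorem scalarFourier_deriv {g : ℝ → ℝ} (hg : ContDiff ℝ ∞ g)
    (hgc : HasCompactSupport g) (τ : ℝ) :
    scalarFourier (deriv g) τ = Complex.I * τ * scalarFourier g τ := by
  have hc : HasCompactSupport (fun x => ((g x : ℝ) : ℂ)) :=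
    hgc.comp_left (g := fun x : ℝ => (x : ℂ)) (by simp)
  have hd : ContDiff ℝ ∞ (fun x => ((g x : ℝ) : ℂ)) := Complex.ofRealCLM.contDiff.comp hg
  have hπ : (Real.pi : ℂ) ≠ 0 := by exact_mod_cast Real.pi_ne_zero
  have hdiff : Differentiable ℝ g := hg.differentiable (by simp)
  have e1 : deriv (fun x => ((g x : ℝ) : ℂ)) = fun x => ((deriv g x : ℝ) : ℂ) := by
    funext x; exact (hdiff x).hasDerivAt.ofReal_comp.deriv
  have hdc : Continuous (deriv g) := hg.continuous_deriv (by simp)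
  have h := Real.fourier_deriv (f := fun x => ((g x : ℝ) : ℂ))
    (hd.continuous.integrable_of_hasCompactSupport hc) (hd.differentiable (by simp))
    (by
      rw [e1]
      exact (Complex.continuous_ofReal.comp hdc).integrable_of_hasCompactSupport
        (hgc.deriv.comp_left (g := fun x : ℝ => (x : ℂ)) (by simp)))
  rw [scalarFourier_eq_fourier, scalarFourier_eq_fourier, ← e1, h]
  simp only [smul_eq_mul]
  push_cast
  field_simp

theorem lintegral_sq_mul_scalarFourier_sq {g : ℝ → ℝ} (hg : ContDiff ℝ ∞ g)
    (hgc : HasCompactSupport g) :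
    ∫⁻ τ : ℝ, ENNReal.ofReal (τ ^ 2) * ‖scalarFourier g τ‖ₑ ^ 2 =
      ENNReal.ofReal (∫ t, deriv g t ^ 2) := by
  have hg' : ContDiff ℝ ∞ (deriv g) :=
    (contDiff_succ_iff_deriv (n := ∞)).1 hg |>.2.2
  rw [← lintegral_scalarFourier_sq hg' hgc.deriv]
  refine lintegral_congr fun τ => ?_
  rw [scalarFourier_deriv hg hgc, enorm_mul, enorm_mul, mul_pow, mul_pow]
  congr 1
  rw [← ofReal_norm, ← ofReal_norm]
  simp [← ENNReal.ofReal_pow]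

/-! ### The modulation pieces -/

theorem Cutoff.eta_sq_le_one (η : Cutoff) (j : ℕ) (x : ℝ) : η.eta j x ^ 2 ≤ 1 := by
  have h1 := η.nonneg x
  have h2 := η.le_one x
  have h3 := η.nonneg (x / 2 ^ j)
  have h4 := η.le_one (x / 2 ^ j)
  have h5 := η.nonneg (x / 2 ^ (j - 1))
  have h6 := η.le_one (x / 2 ^ (j - 1))
  rw [sq_le_one_iff_abs_le_one, abs_le]
  unfold Cutoff.eta
  split_ifs <;> constructor <;> linarith

theorem Cutoff.eq_one (η : Cutoff) {x : ℝ} (hx : |x| ≤ 4 / 3) : η.toFun x = 1 := by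
  refine le_antisymm (η.le_one x) ?_
  have := η.lower x
  rwa [indicator_of_mem] at this
  exact abs_le.1 hx

theorem Cutoff.eq_zero (η : Cutoff) {x : ℝ} (hx : 5 / 3 < |x|) : η.toFun x = 0 := by
  refine le_antisymm ?_ (η.nonneg x)
  have := η.upper x
  rwa [indicator_of_notMem] at this
  exact fun h => absurd (abs_le.2 h) (not_le.2 hx)

theorem Cutoff.eta_sq_le (η : Cutoff) (j : ℕ) (hj : j ≠ 0) (x : ℝ) :
    η.eta j x ^ 2 ≤ 9 / 4 * (1 / 4) ^ j * x ^ 2 := by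
  by_cases h : |x| ≤ 4 / 3 * 2 ^ (j - 1)
  · have h2 : (0 : ℝ) < 2 ^ (j - 1) := by positivity
    have h3 : (2 : ℝ) ^ (j - 1) ≤ 2 ^ j := pow_le_pow_right₀ (by norm_num) (by omega)
    have e : η.eta j x = 0 := by
      rw [Cutoff.eta, if_neg hj, η.eq_one, η.eq_one, sub_self]
      · rw [abs_div, abs_of_pos h2, div_le_iff₀ h2]; exact h
      · rw [abs_div, abs_of_pos (h2.trans_le h3), div_le_iff₀ (h2.trans_le h3)]
        refine h.trans (by gcongr)
    rw [e, zero_pow two_ne_zero]; positivity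
  · refine (η.eta_sq_le_one j x).trans ?_
    push Not at h
    obtain ⟨k, rfl⟩ := Nat.exists_eq_succ_of_ne_zero hj
    simp only [Nat.succ_eq_add_one, Nat.add_sub_cancel] at h
    have h1 : (4 / 3 * 2 ^ k) ^ 2 ≤ x ^ 2 := by
      rw [← sq_abs x]; gcongr
    have h2 : ((1 : ℝ) / 4) ^ (k + 1) = 1 / 4 * ((2 ^ k) ^ 2)⁻¹ := by
      rw [← pow_mul, mul_comm k 2, pow_mul, ← inv_pow, pow_succ]; norm_num; ring
    rw [h2]
    calc (1 : ℝ) = 9 / 4 * (1 / 4 * ((2 ^ k) ^ 2)⁻¹) * (4 / 3 * 2 ^ k) ^ 2 := by field_simp; norm_num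
      _ ≤ _ := by gcongr

theorem lintegral_eta_scalarFourier_le (η : Cutoff) {g : ℝ → ℝ} (hg : ContDiff ℝ ∞ g)
    (hgc : HasCompactSupport g) {a μ L m : ℝ} (hL : 1 ≤ L) (hμ : 0 ≤ μ) (ha : 0 ≤ a)
    (h0 : ∫ t, g t ^ 2 ≤ a / L) (h1 : ∫ t, deriv g t ^ 2 ≤ a * L) (hm : |m| ≤ μ) (j : ℕ) :
    ∫⁻ τ : ℝ, ‖((η.eta j τ : ℝ) : ℂ) * scalarFourier g (τ + m)‖ₑ ^ 2 ≤
      ENNReal.ofReal (a / L * (min 1 (3 * (L + μ) / 2 ^ j)) ^ 2) := by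
  have hL0 : 0 < L := by linarith
  have e : ∀ τ : ℝ, ‖((η.eta j τ : ℝ) : ℂ) * scalarFourier g (τ + m)‖ₑ ^ 2 =
      ENNReal.ofReal (η.eta j τ ^ 2) * ‖scalarFourier g (τ + m)‖ₑ ^ 2 := by
    intro τ
    rw [enorm_mul, mul_pow]
    congr 1
    rw [← ofReal_norm, ← ENNReal.ofReal_pow (norm_nonneg _)]
    simp
  simp_rw [e]
  have hmeas : Measurable (scalarFourier g) := (continuous_scalarFourier hg hgc).measurable
  have hA : ∫⁻ τ : ℝ, ENNReal.ofReal (η.eta j τ ^ 2) * ‖scalarFourier g (τ + m)‖ₑ ^ 2 ≤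
      ENNReal.ofReal (a / L) := by
    calc _ ≤ ∫⁻ τ : ℝ, ‖scalarFourier g (τ + m)‖ₑ ^ 2 := by
          refine lintegral_mono fun τ => ?_
          refine mul_le_of_le_one_left' ?_
          rw [ENNReal.ofReal_le_one]; exact η.eta_sq_le_one j τ
      _ = ∫⁻ τ : ℝ, ‖scalarFourier g τ‖ₑ ^ 2 :=
          lintegral_add_right_eq_self (fun τ => ‖scalarFourier g τ‖ₑ ^ 2) m
      _ ≤ _ := by
          rw [lintegral_scalarFourier_sq hg hgc]; exact ENNReal.ofReal_le_ofReal h0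
  rcases le_or_gt 1 (3 * (L + μ) / 2 ^ j) with h | h
  · rw [min_eq_left h, one_pow, mul_one]; exact hA
  rw [min_eq_right h.le]
  have hj : j ≠ 0 := by
    rintro rfl
    simp only [pow_zero, div_one] at h
    linarith
  calc ∫⁻ τ : ℝ, ENNReal.ofReal (η.eta j τ ^ 2) * ‖scalarFourier g (τ + m)‖ₑ ^ 2
      ≤ ∫⁻ τ : ℝ, ENNReal.ofReal (9 / 2 * (1 / 4) ^ j) *
          ((ENNReal.ofReal ((τ + m) ^ 2) + ENNReal.ofReal (μ ^ 2)) *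
            ‖scalarFourier g (τ + m)‖ₑ ^ 2) := by
        refine lintegral_mono fun τ => ?_
        rw [← mul_assoc]
        refine mul_le_mul_left ?_ _
        rw [← ENNReal.ofReal_add (by positivity) (by positivity),
          ← ENNReal.ofReal_mul (by positivity)]
        refine ENNReal.ofReal_le_ofReal ?_
        refine (η.eta_sq_le j hj τ).trans ?_
        have hm2 : m ^ 2 ≤ μ ^ 2 := by rw [← sq_abs m]; gcongr
        have : τ ^ 2 ≤ 2 * ((τ + m) ^ 2 + μ ^ 2) := by nlinarith [sq_nonneg (τ + 2 * m)]
        calc 9 / 4 * (1 / 4 : ℝ) ^ j * τ ^ 2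
            ≤ 9 / 4 * (1 / 4 : ℝ) ^ j * (2 * ((τ + m) ^ 2 + μ ^ 2)) := by gcongr
          _ = _ := by ring
    _ = ENNReal.ofReal (9 / 2 * (1 / 4) ^ j) * ∫⁻ τ : ℝ,
          ((ENNReal.ofReal ((τ + m) ^ 2) + ENNReal.ofReal (μ ^ 2)) *
            ‖scalarFourier g (τ + m)‖ₑ ^ 2) := by
        rw [lintegral_const_mul]
        fun_prop
    _ = ENNReal.ofReal (9 / 2 * (1 / 4) ^ j) * ∫⁻ τ : ℝ,
          (ENNReal.ofReal (τ ^ 2) + ENNReal.ofReal (μ ^ 2)) * ‖scalarFourier g τ‖ₑ ^ 2 := by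
        rw [lintegral_add_right_eq_self (fun τ => (ENNReal.ofReal (τ ^ 2) + ENNReal.ofReal (μ ^ 2)) *
          ‖scalarFourier g τ‖ₑ ^ 2) m]
    _ ≤ ENNReal.ofReal (9 / 2 * (1 / 4) ^ j) *
          (ENNReal.ofReal (a * L) + ENNReal.ofReal (μ ^ 2) * ENNReal.ofReal (a / L)) := by
        gcongr
        simp_rw [add_mul]
        rw [lintegral_add_left (by fun_prop), lintegral_const_mul _ (by fun_prop),
          lintegral_scalarFourier_sq hg hgc, lintegral_sq_mul_scalarFourier_sq hg hgc]
        gcongr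
    _ ≤ _ := by
        rw [← ENNReal.ofReal_mul (by positivity), ← ENNReal.ofReal_add (by positivity)
          (by positivity), ← ENNReal.ofReal_mul (by positivity)]
        refine ENNReal.ofReal_le_ofReal ?_
        have e4 : ((1 : ℝ) / 4) ^ j = (2 ^ j)⁻¹ ^ 2 := by
          rw [← inv_pow, ← pow_mul, mul_comm j 2, pow_mul]; norm_num
        rw [e4, div_eq_mul_inv (3 * (L + μ)), mul_pow]
        have : a * L + μ ^ 2 * (a / L) ≤ a / L * (L + μ) ^ 2 := by
          have : a * L = a / L * L ^ 2 := by field_simp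
          rw [this]
          have h3 : 0 ≤ a / L := by positivity
          nlinarith [mul_nonneg h3 (mul_nonneg hL0.le hμ)]
        calc 9 / 2 * (2 ^ j)⁻¹ ^ 2 * (a * L + μ ^ 2 * (a / L))
            ≤ 9 * (2 ^ j)⁻¹ ^ 2 * (a / L * (L + μ) ^ 2) := by gcongr; norm_num
          _ = _ := by ring

/-- Summation over the modulations: `∑_j 2^{j/2} min(1, 3R/2^j) ≲ R^{1/2}`. -/
theorem exists_tsum_modulation_le : ∃ C : ℝ, 0 < C ∧ ∀ R : ℝ, 1 ≤ R →
    ∑' j : ℕ, ENNReal.ofReal (2 ^ ((j : ℝ) / 2)) * ENNReal.ofReal (min 1 (3 * R / 2 ^ j)) ≤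
      ENNReal.ofReal (C * √R) := by
  set q : ℝ := √2
  have hq2 : q ^ 2 = 2 := Real.sq_sqrt (by norm_num)
  have hq1 : 1 < q := by rw [Real.lt_sqrt] <;> norm_num
  have hq0 : 0 < q := by linarith
  have hpow : ∀ j : ℕ, (2 : ℝ) ^ ((j : ℝ) / 2) = q ^ j := by
    intro j
    rw [show (j : ℝ) / 2 = (1 / 2) * j by ring, Real.rpow_mul (by norm_num), Real.rpow_natCast,
      ← Real.sqrt_eq_rpow]
  have hqi : q⁻¹ < 1 := inv_lt_one_of_one_lt₀ hq1
  refine ⟨q / (q - 1) + 3 * (1 - q⁻¹)⁻¹, ?_, fun R hR => ?_⟩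
  · have : 0 < 1 - q⁻¹ := by linarith
    have : 0 < q - 1 := by linarith
    positivity
  obtain ⟨n, hn1, hn2⟩ := exists_nat_pow_near hR (one_lt_two : (1 : ℝ) < 2)
  have hs1 : q ^ n ≤ √R := by
    refine Real.le_sqrt_of_sq_le ?_
    rwa [← pow_mul, mul_comm, pow_mul, hq2]
  have hs2 : √R ≤ q ^ (n + 1) := by
    refine Real.sqrt_le_iff.2 ⟨by positivity, ?_⟩
    rw [← pow_mul, mul_comm, pow_mul, hq2]; exact hn2.le
  set f : ℕ → ℝ := fun j => q ^ j * min 1 (3 * R / 2 ^ j)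
  have hf : ∀ j, 0 ≤ f j := fun j => by positivity
  have hf1 : ∀ j, f j ≤ q ^ j := fun j => mul_le_of_le_one_right (by positivity) (min_le_left _ _)
  have hf2 : ∀ j, f (j + (n + 1)) ≤ 3 * √R * q⁻¹ ^ j := by
    intro j
    calc f (j + (n + 1)) ≤ q ^ (j + (n + 1)) * (3 * R / 2 ^ (j + (n + 1))) := by
          simp only [f]; gcongr; exact min_le_right _ _
      _ = 3 * R / q ^ (n + 1) * q⁻¹ ^ j := by
          rw [← hq2, ← pow_mul, inv_pow]; field_simp; ring
      _ ≤ _ := by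
          gcongr
          rw [div_le_iff₀ (by positivity)]
          nlinarith [Real.sq_sqrt (by linarith : (0 : ℝ) ≤ R), Real.sqrt_nonneg R]
  have hgeo : Summable fun j : ℕ => 3 * √R * q⁻¹ ^ j :=
    (summable_geometric_of_lt_one (by positivity) hqi).mul_left _
  have hsum' : Summable fun j => f (j + (n + 1)) :=
    Summable.of_nonneg_of_le (fun j => hf _) hf2 hgeo
  have hsum : Summable f := (summable_nat_add_iff (n + 1)).1 hsum'
  have e : ∀ j : ℕ, ENNReal.ofReal (2 ^ ((j : ℝ) / 2)) *
      ENNReal.ofReal (min 1 (3 * R / 2 ^ j)) = ENNReal.ofReal (f j) := by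
    intro j
    rw [hpow, ← ENNReal.ofReal_mul (by positivity)]
  simp_rw [e]
  rw [← ENNReal.ofReal_tsum_of_nonneg hf hsum]
  refine ENNReal.ofReal_le_ofReal ?_
  rw [← hsum.sum_add_tsum_nat_add (n + 1), add_mul]
  refine add_le_add ?_ ?_
  · calc ∑ j ∈ Finset.range (n + 1), f j ≤ ∑ j ∈ Finset.range (n + 1), q ^ j :=
          Finset.sum_le_sum fun j _ => hf1 j
      _ = (q ^ (n + 1) - 1) / (q - 1) := geom_sum_eq hq1.ne' _
      _ ≤ q * √R / (q - 1) := by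
          have : 0 < q - 1 := by linarith
          gcongr
          rw [pow_succ]; nlinarith
      _ = _ := by ring
  · calc ∑' j, f (j + (n + 1)) ≤ ∑' j : ℕ, 3 * √R * q⁻¹ ^ j := hsum'.tsum_le_tsum hf2 hgeo
      _ = _ := by rw [tsum_mul_left, tsum_geometric_of_lt_one (by positivity) hqi]; ring

/-- The `X_{N,σ}` norm of a wave with a time cutoff. -/
theorem exists_normX_wave_le : ∃ C : ℝ, 0 < C ∧ ∀ (η : Cutoff) (d : ℕ) (σ : ℝ)
    (p : C(RSpace d, ℝ)) (S : Compacts (RSpace d)) (g : ℝ → ℝ), ContDiff ℝ ∞ g →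
    HasCompactSupport g → ∀ a μ L : ℝ, 1 ≤ L → 0 ≤ μ → 0 ≤ a → ∫ t, g t ^ 2 ≤ a / L →
    ∫ t, deriv g t ^ 2 ≤ a * L → (∀ ξ ∈ S, |p ξ - σ * ‖ξ‖ ^ 2| ≤ μ) →
    η.normX σ (spaceTimeFourier fun t => (g t : ℂ) • wave p S t) ≤
      ENNReal.ofReal (C * √a * √(1 + μ / L) * √(volume.real (S : Set (RSpace d)))) := by
  obtain ⟨C, hC, hsum⟩ := exists_tsum_modulation_le
  refine ⟨C, hC, ?_⟩
  intro η d σ p S g hg hgc a μ L hL hμ ha h0 h1 hp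
  have hL0 : 0 < L := by linarith
  set V := volume.real (S : Set (RSpace d))
  have hV : volume (S : Set (RSpace d)) = ENNReal.ofReal V :=
    (ENNReal.ofReal_toReal S.isCompact.measure_lt_top.ne).symm
  have hπ : (((2 * Real.pi) ^ (-(d : ℝ) / 2) : ℝ)) ≤ 1 := by
    refine Real.rpow_le_one_of_one_le_of_nonpos ?_ ?_
    · linarith [Real.pi_gt_three]
    · have : (0 : ℝ) ≤ d := by positivity
      linarith
  have hmeas : Measurable (scalarFourier g) := (continuous_scalarFourier hg hgc).measurable
  have hetac : ∀ j, Continuous (η.eta j) := by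
    intro j
    have : Continuous η.toFun := η.smooth.continuous
    unfold Cutoff.eta
    split_ifs
    · exact this
    · fun_prop
  have key : ∀ j : ℕ, (∫⁻ τ : ℝ, ∫⁻ ξ : RSpace d, ‖((η.eta j (τ + σ * ‖ξ‖ ^ 2) : ℝ) : ℂ) *
      spaceTimeFourier (fun t => (g t : ℂ) • wave p S t) τ ξ‖ₑ ^ 2) ^ (1 / 2 : ℝ) ≤
      ENNReal.ofReal (√(a / L) * √V) * ENNReal.ofReal (min 1 (3 * (L + μ) / 2 ^ j)) := by
    intro j
    set X := min 1 (3 * (L + μ) / 2 ^ j)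
    have hX : 0 ≤ X := by positivity
    have main : ∫⁻ τ : ℝ, ∫⁻ ξ : RSpace d, ‖((η.eta j (τ + σ * ‖ξ‖ ^ 2) : ℝ) : ℂ) *
        spaceTimeFourier (fun t => (g t : ℂ) • wave p S t) τ ξ‖ₑ ^ 2 ≤
        ENNReal.ofReal (a / L * V * X ^ 2) := by
      calc _ ≤ ∫⁻ τ : ℝ, ∫⁻ ξ : RSpace d, (S : Set (RSpace d)).indicator (fun ξ =>
              ‖((η.eta j (τ + σ * ‖ξ‖ ^ 2) : ℝ) : ℂ) * scalarFourier g (τ + p ξ)‖ₑ ^ 2) ξ := by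
            refine lintegral_mono fun τ => lintegral_mono_ae ?_
            filter_upwards [spaceTimeFourier_smul_wave p S hg.continuous hgc τ] with ξ hξ
            rw [hξ]
            by_cases hS : ξ ∈ (S : Set (RSpace d))
            · simp only [hS, indicator_of_mem]
              rw [mul_left_comm, enorm_mul, mul_pow]
              refine mul_le_of_le_one_left' (pow_le_one' ?_ 2)
              rw [← ofReal_norm, ENNReal.ofReal_le_one, Complex.norm_real,
                Real.norm_of_nonneg (by positivity)]
              exact hπ
            · simp [hS]
        _ = ∫⁻ ξ : RSpace d, ∫⁻ τ : ℝ, (S : Set (RSpace d)).indicator (fun ξ =>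
              ‖((η.eta j (τ + σ * ‖ξ‖ ^ 2) : ℝ) : ℂ) * scalarFourier g (τ + p ξ)‖ₑ ^ 2) ξ := by
            refine lintegral_lintegral_swap ?_
            have hm : Measurable fun x : ℝ × RSpace d =>
                ‖((η.eta j (x.1 + σ * ‖x.2‖ ^ 2) : ℝ) : ℂ) * scalarFourier g (x.1 + p x.2)‖ₑ ^ 2 := by
              have h1 : Measurable fun x : ℝ × RSpace d =>
                  ((η.eta j (x.1 + σ * ‖x.2‖ ^ 2) : ℝ) : ℂ) := by
                have := hetac j
                exact Continuous.measurable (by fun_prop)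
              have h2 : Measurable fun x : ℝ × RSpace d => scalarFourier g (x.1 + p x.2) :=
                hmeas.comp (Continuous.measurable (by fun_prop))
              exact ((h1.mul h2).enorm).pow_const 2
            have := hm.indicator (measurable_snd S.isCompact.measurableSet)
            exact this.aemeasurable
        _ ≤ ∫⁻ ξ : RSpace d, (S : Set (RSpace d)).indicator
              (fun _ => ENNReal.ofReal (a / L * X ^ 2)) ξ := by
            refine lintegral_mono fun ξ => ?_
            by_cases hS : ξ ∈ (S : Set (RSpace d))
            · simp only [hS, indicator_of_mem]
              rw [← lintegral_add_right_eq_self _ (-(σ * ‖ξ‖ ^ 2))]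
              refine le_trans (le_of_eq ?_)
                (lintegral_eta_scalarFourier_le η hg hgc hL hμ ha h0 h1 (hp ξ hS) j)
              refine lintegral_congr fun τ => ?_
              congr 4
              · ring_nf
              · ring
            · simp [hS]
        _ = ENNReal.ofReal (a / L * V * X ^ 2) := by
            rw [lintegral_indicator S.isCompact.measurableSet, setLIntegral_const, hV,
              ← ENNReal.ofReal_mul (by positivity)]
            congr 1; ring
    calc _ ≤ (ENNReal.ofReal (a / L * V * X ^ 2)) ^ (1 / 2 : ℝ) := by gcongr
      _ = _ := by
        rw [ENNReal.ofReal_rpow_of_nonneg (by positivity) (by norm_num), ← Real.sqrt_eq_rpow,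
          ← ENNReal.ofReal_mul (by positivity), Real.sqrt_mul (by positivity),
          Real.sqrt_mul (by positivity), Real.sqrt_sq hX]
  unfold Cutoff.normX
  calc _ ≤ ∑' j : ℕ, ENNReal.ofReal (√(a / L) * √V) * (ENNReal.ofReal (2 ^ ((j : ℝ) / 2)) *
        ENNReal.ofReal (min 1 (3 * (L + μ) / 2 ^ j))) := by
        refine ENNReal.tsum_le_tsum fun j => ?_
        rw [mul_left_comm]
        exact mul_le_mul_right (key j) _
    _ ≤ ENNReal.ofReal (√(a / L) * √V) * ENNReal.ofReal (C * √(L + μ)) := by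
        rw [ENNReal.tsum_mul_left]
        exact mul_le_mul_right (hsum _ (by linarith)) _
    _ = _ := by
        rw [← ENNReal.ofReal_mul (by positivity)]
        congr 1
        have : 1 + μ / L = (L + μ) / L := by field_simp
        rw [this, Real.sqrt_div ha, Real.sqrt_div (by positivity)]
        ring

/-! ### The short-time norms -/

theorem Cutoff.hasCompactSupport (η : Cutoff) : HasCompactSupport η.toFun :=
  HasCompactSupport.intro (isCompact_Icc (a := -(5 / 3 : ℝ)) (b := 5 / 3)) fun x hx =>
    η.eq_zero (by
      by_contra h
      exact hx (abs_le.1 (not_lt.1 h)))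

theorem integral_sq_le_of_support {f : ℝ → ℝ} {M c r : ℝ} (hr : 0 ≤ r)
    (hf : ∀ x, |f x| ≤ M) (hs : ∀ x, r < |x - c| → f x = 0) :
    ∫ x, f x ^ 2 ≤ M ^ 2 * (2 * r) := by
  have h1 : ∀ x, f x ^ 2 ≤ (Icc (c - r) (c + r)).indicator (fun _ => M ^ 2) x := by
    intro x
    by_cases hx : x ∈ Icc (c - r) (c + r)
    · rw [indicator_of_mem hx, ← sq_abs]
      exact pow_le_pow_left₀ (abs_nonneg _) (hf x) 2
    · rw [indicator_of_notMem hx, hs x]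
      · simp
      · by_contra h
        have := abs_le.1 (not_lt.1 h)
        exact hx ⟨by linarith [this.1], by linarith [this.2]⟩
  calc ∫ x, f x ^ 2 ≤ ∫ x, (Icc (c - r) (c + r)).indicator (fun _ => M ^ 2) x := by
        refine integral_mono_of_nonneg (Eventually.of_forall fun x => sq_nonneg _) ?_
          (Eventually.of_forall h1)
        exact (continuous_const.integrableOn_Icc).integrable_indicator measurableSet_Icc
    _ = _ := by
        rw [integral_indicator measurableSet_Icc, setIntegral_const, measureReal_def,
          Real.volume_Icc, ENNReal.toReal_ofReal (by linarith), smul_eq_mul]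
        ring

/-- The short-time norm of a wave with time cutoff `η(λ t)`. -/
theorem exists_normFGlobal_wave_le (η : Cutoff) : ∃ K : ℝ, 0 < K ∧ ∀ (d : ℕ) (σ : ℝ)
    (p : C(RSpace d, ℝ)) (S : Compacts (RSpace d)) (N : ℕ) (T l μ : ℝ), 1 ≤ N → 0 < T → T ≤ 1 →
    1 ≤ l → 0 ≤ μ → (∀ ξ ∈ S, |p ξ - σ * ‖ξ‖ ^ 2| ≤ μ) →
    η.normFGlobal N σ T (fun t => (η.toFun (l * t) : ℂ) • wave p S t) ≤
      ENNReal.ofReal (K * √(1 + μ / max (N / T) l) * √(volume.real (S : Set (RSpace d)))) := by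
  obtain ⟨C, hC, hX⟩ := exists_normX_wave_le
  have hdc : Continuous (deriv η.toFun) := η.smooth.continuous_deriv (by simp)
  obtain ⟨D, hD⟩ := (η.hasCompactSupport.deriv).exists_bound_of_continuous hdc
  have hD0 : 0 ≤ D := (norm_nonneg _).trans (hD 0)
  refine ⟨C * √((1 + (2 * D) ^ 2) * (10 / 3)), by positivity, ?_⟩
  intro d σ p S N T l μ hN hT hT1 hl hμ hp
  have hdiff : Differentiable ℝ η.toFun := η.smooth.differentiable (by simp)
  set a : ℝ := N / T
  have ha : 1 ≤ a := by
    have : (1 : ℝ) ≤ N := by exact_mod_cast hN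
    rw [le_div_iff₀ hT]; linarith
  set L := max a l
  have hL : 1 ≤ L := ha.trans (le_max_left _ _)
  have hL0 : 0 < L := by linarith
  refine iSup_le fun tN => ?_
  set g : ℝ → ℝ := fun t => η.toFun (a * (t - tN)) * η.toFun (l * t)
  have e : (fun t => ((η.eta 0 (N * T⁻¹ * (t - tN)) : ℝ) : ℂ) •
      ((η.toFun (l * t) : ℂ) • wave p S t)) = fun t => (g t : ℂ) • wave p S t := by
    funext t
    rw [smul_smul]
    simp [g, Cutoff.eta, a, div_eq_mul_inv]
  rw [e]
  have hg : ContDiff ℝ ∞ g := by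
    have := η.smooth
    exact (this.comp (by fun_prop)).mul (this.comp (by fun_prop))
  have hgs : ∀ t, 5 / 3 / a < |t - tN| ∨ 5 / 3 / l < |t - 0| → g t = 0 := by
    intro t ht
    rcases ht with h | h
    · simp only [g]
      rw [η.eq_zero, zero_mul]
      rw [abs_mul, abs_of_pos (by linarith)]
      rwa [div_lt_iff₀ (by linarith), mul_comm] at h
    · simp only [g]
      rw [η.eq_zero (x := l * t), mul_zero]
      rw [abs_mul, abs_of_pos (by linarith)]
      rwa [div_lt_iff₀ (by linarith), mul_comm, sub_zero] at h
  obtain ⟨c, hgs'⟩ : ∃ c, ∀ t, 5 / 3 / L < |t - c| → g t = 0 := by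
    rcases max_choice a l with h | h
    · exact ⟨tN, fun t ht => hgs t (Or.inl (by rwa [← h]))⟩
    · exact ⟨0, fun t ht => hgs t (Or.inr (by rwa [← h]))⟩
  have hgc : HasCompactSupport g :=
    HasCompactSupport.intro (isCompact_closedBall c (5 / 3 / L)) fun x hx => hgs' x (by
      rwa [Metric.mem_closedBall, Real.dist_eq, not_le] at hx)
  have hgs2 : ∀ t, 5 / 3 / L < |t - c| → deriv g t = 0 := by
    intro t ht
    have hev : g =ᶠ[nhds t] fun _ => 0 := by
      have : {t | 5 / 3 / L < |t - c|} ∈ nhds t :=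
        (isOpen_lt continuous_const (by fun_prop)).mem_nhds ht
      filter_upwards [this] with s hs using hgs' s hs
    rw [hev.deriv_eq]; simp
  have hb : ∀ x, |g x| ≤ 1 := by
    intro x
    rw [abs_of_nonneg (mul_nonneg (η.nonneg _) (η.nonneg _))]
    exact mul_le_one₀ (η.le_one _) (η.nonneg _) (η.le_one _)
  have hb2 : ∀ x, |deriv g x| ≤ 2 * D * L := by
    intro x
    have d1 : HasDerivAt (fun t => η.toFun (a * (t - tN))) (deriv η.toFun (a * (x - tN)) * a) x := by
      have := (hdiff (a * (x - tN))).hasDerivAt.comp x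
        (((hasDerivAt_id' x).sub_const tN).const_mul a)
      rwa [mul_one] at this
    have d2 : HasDerivAt (fun t => η.toFun (l * t)) (deriv η.toFun (l * x) * l) x := by
      have := (hdiff (l * x)).hasDerivAt.comp x ((hasDerivAt_id' x).const_mul l)
      rwa [mul_one] at this
    have hd : HasDerivAt g _ x := d1.mul d2
    rw [hd.deriv]
    have b1 : |deriv η.toFun (a * (x - tN)) * a * η.toFun (l * x)| ≤ D * L := by
      rw [abs_mul, abs_mul, abs_of_nonneg (η.nonneg _), abs_of_pos (by linarith : 0 < a)]
      calc _ ≤ D * L * 1 := by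
            gcongr
            · exact η.nonneg _
            · exact hD _
            · exact le_max_left _ _
            · exact η.le_one _
        _ = _ := mul_one _
    have b2 : |η.toFun (a * (x - tN)) * (deriv η.toFun (l * x) * l)| ≤ D * L := by
      rw [abs_mul, abs_mul, abs_of_nonneg (η.nonneg _), abs_of_pos (by linarith : 0 < l)]
      calc _ ≤ 1 * (D * L) := by
            gcongr
            · exact η.le_one _
            · exact hD _
            · exact le_max_right _ _
        _ = _ := one_mul _
    refine (abs_add_le _ _).trans ?_
    linarith
  have i1 : ∫ t, g t ^ 2 ≤ (1 + (2 * D) ^ 2) * (10 / 3) / L := by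
    refine (integral_sq_le_of_support (by positivity) hb hgs').trans ?_
    rw [show (1 : ℝ) ^ 2 * (2 * (5 / 3 / L)) = 10 / 3 / L by ring]
    gcongr
    nlinarith [sq_nonneg (2 * D)]
  have i2 : ∫ t, deriv g t ^ 2 ≤ (1 + (2 * D) ^ 2) * (10 / 3) * L := by
    refine (integral_sq_le_of_support (by positivity) hb2 hgs2).trans ?_
    rw [show (2 * D * L) ^ 2 * (2 * (5 / 3 / L)) = (2 * D) ^ 2 * (10 / 3) * L by field_simp; ring]
    gcongr
    linarith
  exact hX η d σ p S g hg hgc _ μ L hL hμ (by positivity) i1 i2 hp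

theorem Cutoff.memFGlobal_wave (η : Cutoff) (σ : ℝ)
    (p : C(RSpace d, ℝ)) (S : Compacts (RSpace d)) {N : ℕ} {T l : ℝ} (hN : 1 ≤ N) (hT : 0 < T)
    (hT1 : T ≤ 1) (hl : 1 ≤ l) (hS : (S : Set (RSpace d)) ⊆ dyadicRegion d N) :
    η.MemFGlobal N σ T (fun t => (η.toFun (l * t) : ℂ) • wave p S t) := by
  have hηc : Continuous η.toFun := η.smooth.continuous
  refine ⟨?_, ?_, ?_, ?_⟩
  · have := continuous_wave p S
    fun_prop
  · intro t ht
    rw [η.eq_zero, Complex.ofReal_zero, zero_smul]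
    have : 4 < |t| := by
      by_contra h
      exact ht (abs_le.1 (not_lt.1 h))
    rw [abs_mul, abs_of_pos (by linarith)]
    nlinarith
  · intro τ
    have hgc : HasCompactSupport fun t => η.toFun (l * t) :=
      HasCompactSupport.intro (isCompact_closedBall (0 : ℝ) (5 / 3)) fun x hx => η.eq_zero (by
        rw [Metric.mem_closedBall, Real.dist_eq, not_le, sub_zero] at hx
        rw [abs_mul, abs_of_pos (by linarith)]
        nlinarith)
    filter_upwards [spaceTimeFourier_smul_wave p S (g := fun t => η.toFun (l * t))
      (by fun_prop) hgc τ] with ξ hξ hn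
    rw [hξ, indicator_of_notMem (fun h => hn (hS h)), mul_zero]
  · obtain ⟨K, -, hK⟩ := exists_normFGlobal_wave_le η
    obtain ⟨μ, hμ⟩ := S.isCompact.exists_bound_of_continuousOn
      (f := fun ξ => p ξ - σ * ‖ξ‖ ^ 2) (by fun_prop)
    refine (hK d σ p S N T l (max μ 0) hN hT hT1 hl (le_max_right _ _)
      fun ξ hξ => (hμ ξ hξ).trans (le_max_left _ _)).trans_lt ENNReal.ofReal_lt_top

/-! ### Lower bound for the trilinear integral -/

theorem integral_conj_wave_mul_wave_mul_wave (p₁ p₂ p₃ : C(RSpace d, ℝ))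
    (S₁ S₂ S₃ : Compacts (RSpace d)) (hS : ∀ ξ ∈ S₂, ∀ ξ' ∈ S₃, ξ + ξ' ∈ S₁) (t : ℝ) :
    ∫ x, (starRingEnd ℂ) (wave p₁ S₁ t x) * wave p₂ S₂ t x * wave p₃ S₃ t x =
      ∫ z in ((fun ζ : RSpace d => (2 * Real.pi) • ζ) ⁻¹' S₂) ×ˢ
          ((fun ζ : RSpace d => (2 * Real.pi) • ζ) ⁻¹' S₃),
        Complex.exp (((t * (p₁ ((2 * Real.pi) • z.1 + (2 * Real.pi) • z.2) -
          p₂ ((2 * Real.pi) • z.1) - p₃ ((2 * Real.pi) • z.2)) : ℝ) : ℂ) * Complex.I) := by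
  have hm := fun (i : C(RSpace d, ℝ)) (S : Compacts (RSpace d)) =>
    memLp_indicator_smul 2 (phaseFactor i t) S
  have hi := fun (i : C(RSpace d, ℝ)) (S : Compacts (RSpace d)) =>
    memLp_one_iff_integrable.1 (memLp_indicator_smul 1 (phaseFactor i t) S)
  have h := integral_conj_mul_mul_fourierInv (hm p₁ S₁) (hm p₂ S₂) (hm p₃ S₃)
    (hi p₂ S₂) (hi p₃ S₃)
  set K₂ := (fun ζ : RSpace d => (2 * Real.pi) • ζ) ⁻¹' (S₂ : Set (RSpace d))
  set K₃ := (fun ζ : RSpace d => (2 * Real.pi) • ζ) ⁻¹' (S₃ : Set (RSpace d))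
  have hK₂ : MeasurableSet K₂ := (measurable_const_smul _) S₂.isCompact.measurableSet
  have hK₃ : MeasurableSet K₃ := (measurable_const_smul _) S₃.isCompact.measurableSet
  set q : RSpace d × RSpace d → ℂ := fun z =>
    Complex.exp (((t * (p₁ ((2 * Real.pi) • z.1 + (2 * Real.pi) • z.2) -
          p₂ ((2 * Real.pi) • z.1) - p₃ ((2 * Real.pi) • z.2)) : ℝ) : ℂ) * Complex.I)
  have hpt : ∀ ζ y : RSpace d, (S₂ : Set (RSpace d)).indicator (phaseFactor p₂ t)
      ((2 * Real.pi) • ζ) * ((starRingEnd ℂ) ((S₁ : Set (RSpace d)).indicator (phaseFactor p₁ t)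
        ((2 * Real.pi) • (y + ζ))) * (S₃ : Set (RSpace d)).indicator (phaseFactor p₃ t)
          ((2 * Real.pi) • (y + ζ - ζ))) = (K₂ ×ˢ K₃).indicator q (ζ, y) := by
    intro ζ y
    rw [add_sub_cancel_right, smul_add]
    by_cases h2 : (2 * Real.pi) • ζ ∈ (S₂ : Set (RSpace d))
    · by_cases h3 : (2 * Real.pi) • y ∈ (S₃ : Set (RSpace d))
      · have h1 : (2 * Real.pi) • y + (2 * Real.pi) • ζ ∈ (S₁ : Set (RSpace d)) := by
          rw [add_comm]; exact hS _ h2 _ h3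
        rw [indicator_of_mem h2, indicator_of_mem h3, indicator_of_mem h1,
          indicator_of_mem (show (ζ, y) ∈ K₂ ×ˢ K₃ from ⟨h2, h3⟩)]
        simp only [phaseFactor, ContinuousMap.coe_mk, q]
        rw [← Complex.exp_conj, ← Complex.exp_add, ← Complex.exp_add,
          add_comm ((2 * Real.pi) • y)]
        congr 1
        simp only [map_mul, Complex.conj_I, Complex.conj_ofReal]
        push_cast; ring
      · rw [indicator_of_notMem h3,
          indicator_of_notMem (show (ζ, y) ∉ K₂ ×ˢ K₃ from fun h => h3 h.2)]
        simp
    · rw [indicator_of_notMem h2,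
        indicator_of_notMem (show (ζ, y) ∉ K₂ ×ˢ K₃ from fun h => h2 h.1)]
      simp
  have hpr : ∀ p S, wave p S t = (𝓕⁻ ((hm p S).toLp _) : L2Space d) := fun p S => rfl
  rw [hpr p₁, hpr p₂, hpr p₃, h, ← integral_indicator (hK₂.prod hK₃), Measure.volume_eq_prod,
    integral_prod]
  · refine integral_congr_ae (Eventually.of_forall fun ζ => ?_)
    simp only
    rw [← integral_add_right_eq_self _ ζ, ← integral_const_mul]
    exact integral_congr_ae (Eventually.of_forall fun y => hpt ζ y)
  · have h1 := (memLp_one_iff_integrable.1 (memLp_indicator_smul 1 1 S₂)).mul_prod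
      (memLp_one_iff_integrable.1 (memLp_indicator_smul 1 1 S₃))
    have h2 := h1.bdd_mul (c := 1) (f := q)
      (Continuous.aestronglyMeasurable (by fun_prop))
      (Eventually.of_forall fun x => (Complex.norm_exp_ofReal_mul_I _).le)
    refine h2.congr (Eventually.of_forall fun x => ?_)
    by_cases h2 : (2 * Real.pi) • x.1 ∈ (S₂ : Set (RSpace d))
    · by_cases h3 : (2 * Real.pi) • x.2 ∈ (S₃ : Set (RSpace d))
      · simp only
        rw [indicator_of_mem h2, indicator_of_mem h3,
          indicator_of_mem (show x ∈ K₂ ×ˢ K₃ from ⟨h2, h3⟩)]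
        simp only [ContinuousMap.one_apply, mul_one, q]
      · simp only
        rw [indicator_of_notMem h3,
          indicator_of_notMem (show x ∉ K₂ ×ˢ K₃ from fun h => h3 h.2)]
        simp
    · simp only
      rw [indicator_of_notMem h2,
        indicator_of_notMem (show x ∉ K₂ ×ˢ K₃ from fun h => h2 h.1)]
      simp

theorem volume_real_preimage_smul (S : Compacts (RSpace d)) :
    volume.real ((fun ζ : RSpace d => (2 * Real.pi) • ζ) ⁻¹' S) =
      ((2 * Real.pi) ^ d)⁻¹ * volume.real (S : Set (RSpace d)) := by
  have hπ : (0 : ℝ) < 2 * Real.pi := by positivity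
  rw [measureReal_def, Measure.addHaar_preimage_smul _ hπ.ne', ENNReal.toReal_mul,
    ENNReal.toReal_ofReal (abs_nonneg _), abs_of_pos (by positivity), measureReal_def]
  simp

theorem trilinearIntegral_wave_ge (p₁ p₂ p₃ : C(RSpace d, ℝ))
    (S₁ S₂ S₃ : Compacts (RSpace d)) (hS : ∀ ξ ∈ S₂, ∀ ξ' ∈ S₃, ξ + ξ' ∈ S₁)
    {T : ℝ} (hT : 0 ≤ T) {M : ℕ} {L : ℝ} (hL : T / M * L ≤ 1)
    (hp : ∀ ξ ∈ S₂, ∀ ξ' ∈ S₃, |p₁ (ξ + ξ') - p₂ ξ - p₃ ξ'| ≤ L) {u v w : ℝ → L2Space d}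
    (hu : EqOn u (wave p₁ S₁) (Icc 0 (T / M))) (hv : EqOn v (wave p₂ S₂) (Icc 0 (T / M)))
    (hw : EqOn w (wave p₃ S₃) (Icc 0 (T / M))) :
    T / M / 2 * (((2 * Real.pi) ^ d)⁻¹ ^ 2 * volume.real (S₂ : Set (RSpace d)) *
      volume.real (S₃ : Set (RSpace d))) ≤ trilinearIntegral T M u v w := by
  have hTM : 0 ≤ T / M := by positivity
  set K₂ := (fun ζ : RSpace d => (2 * Real.pi) • ζ) ⁻¹' (S₂ : Set (RSpace d))
  set K₃ := (fun ζ : RSpace d => (2 * Real.pi) • ζ) ⁻¹' (S₃ : Set (RSpace d))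
  have hc : ∀ S : Compacts (RSpace d),
      IsCompact ((fun ζ : RSpace d => (2 * Real.pi) • ζ) ⁻¹' (S : Set (RSpace d))) := fun S =>
    (Homeomorph.smulOfNeZero (2 * Real.pi) (by positivity)).isCompact_preimage.2 S.isCompact
  have hK : IsCompact (K₂ ×ˢ K₃) := (hc S₂).prod (hc S₃)
  set q : ℝ → RSpace d × RSpace d → ℂ := fun t z =>
    Complex.exp (((t * (p₁ ((2 * Real.pi) • z.1 + (2 * Real.pi) • z.2) -
          p₂ ((2 * Real.pi) • z.1) - p₃ ((2 * Real.pi) • z.2)) : ℝ) : ℂ) * Complex.I)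
  have e1 : trilinearIntegral T M u v w =
      ‖∫ t in Icc 0 (T / M), ∫ z in K₂ ×ˢ K₃, q t z‖ := by
    unfold trilinearIntegral
    rw [← integral_indicator measurableSet_Icc]
    congr 1
    refine integral_congr_ae (Eventually.of_forall fun t => ?_)
    by_cases ht : t ∈ Icc 0 (T / M)
    · simp only
      rw [indicator_of_mem ht, ← integral_conj_wave_mul_wave_mul_wave p₁ p₂ p₃ S₁ S₂ S₃ hS t]
      have e : timeWindow T M t = 1 := by rw [timeWindow, indicator_of_mem ht]; rfl
      rw [e, hu ht, hv ht, hw ht]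
      simp only [one_mul]
    · simp only
      rw [indicator_of_notMem ht]
      have e : timeWindow T M t = 0 := by rw [timeWindow, indicator_of_notMem ht]
      rw [e]
      simp
  have f1 : IsFiniteMeasure ((volume : Measure ℝ).restrict (Icc 0 (T / M))) :=
    ⟨by simp⟩
  have f2 : IsFiniteMeasure ((volume : Measure (RSpace d × RSpace d)).restrict (K₂ ×ˢ K₃)) :=
    ⟨by simpa using hK.measure_lt_top⟩
  set ν := ((volume : Measure ℝ).restrict (Icc 0 (T / M))).prod
    ((volume : Measure (RSpace d × RSpace d)).restrict (K₂ ×ˢ K₃))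
  have hq : Integrable (Function.uncurry q) ν :=
    Integrable.of_bound (C := 1) (Continuous.aestronglyMeasurable (by
      simp only [Function.uncurry_def, q]; fun_prop))
      (Eventually.of_forall fun x => (Complex.norm_exp_ofReal_mul_I _).le)
  rw [e1, integral_integral hq]
  refine le_trans ?_ (Complex.re_le_norm _)
  have e2 : (∫ z, q z.1 z.2 ∂ν).re = ∫ z, (q z.1 z.2).re ∂ν := (integral_re hq).symm
  rw [e2]
  have hge : ∀ᵐ z ∂ν, (1 / 2 : ℝ) ≤ (q z.1 z.2).re := by
    have hms : MeasurableSet (Icc 0 (T / M) ×ˢ (K₂ ×ˢ K₃)) :=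
      measurableSet_Icc.prod hK.measurableSet
    have : ν = (volume.prod volume).restrict (Icc 0 (T / M) ×ˢ (K₂ ×ˢ K₃)) :=
      Measure.prod_restrict _ _
    rw [this]
    refine (ae_restrict_iff' hms).2 (Eventually.of_forall fun z hz => ?_)
    simp only [q]
    rw [Complex.exp_ofReal_mul_I_re]
    set x := z.1 * (p₁ ((2 * Real.pi) • z.2.1 + (2 * Real.pi) • z.2.2) -
          p₂ ((2 * Real.pi) • z.2.1) - p₃ ((2 * Real.pi) • z.2.2))
    have hx : |x| ≤ 1 := by
      rw [abs_mul, abs_of_nonneg hz.1.1]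
      refine le_trans (mul_le_mul hz.1.2 (hp _ hz.2.1 _ hz.2.2) (abs_nonneg _) hTM) hL
    have := Real.one_sub_sq_div_two_le_cos (x := x)
    have hx2 : x ^ 2 ≤ 1 := by rw [← sq_abs]; exact pow_le_one₀ (abs_nonneg _) hx
    linarith
  have hν : ν.real univ = T / M * (((2 * Real.pi) ^ d)⁻¹ ^ 2 *
      volume.real (S₂ : Set (RSpace d)) * volume.real (S₃ : Set (RSpace d))) := by
    have : ν univ = volume (Icc 0 (T / M)) * (volume K₂ * volume K₃) := by
      rw [← univ_prod_univ, Measure.prod_prod, Measure.restrict_apply_univ,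
        Measure.restrict_apply_univ, Measure.volume_eq_prod, Measure.prod_prod]
    rw [measureReal_def, this, ENNReal.toReal_mul, ENNReal.toReal_mul, Real.volume_Icc,
      ENNReal.toReal_ofReal (by linarith), ← measureReal_def, ← measureReal_def,
      volume_real_preimage_smul, volume_real_preimage_smul]
    ring
  calc _ = ∫ _, (1 / 2 : ℝ) ∂ν := by
        rw [integral_const, hν, smul_eq_mul]; ring
    _ ≤ _ := integral_mono_ae (integrable_const _) hq.re hge

/-! ### Boxes -/

/-- The closed box with centre `c` and half side lengths `r`. -/
def box (c : RSpace d) (r : Fin d → ℝ) : Compacts (RSpace d) where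
  carrier := {ξ | ∀ i, |ξ i - c i| ≤ r i}
  isCompact' := by
    have h : {ξ : RSpace d | ∀ i, |ξ i - c i| ≤ r i} =
        (EuclideanSpace.equiv (Fin d) ℝ).toHomeomorph ⁻¹'
          Icc (fun i => c i - r i) (fun i => c i + r i) := by
      ext ξ
      simp only [mem_ofPred_eq, mem_preimage, mem_Icc, Pi.le_def, ← forall_and]
      refine forall_congr' fun i => ?_
      rw [abs_le]
      change _ ↔ c i - r i ≤ ξ i ∧ ξ i ≤ c i + r i
      constructor <;> intro h <;> constructor <;> linarith [h.1, h.2]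
    rw [h, Homeomorph.isCompact_preimage]
    exact isCompact_Icc

theorem mem_box {c : RSpace d} {r : Fin d → ℝ} {ξ : RSpace d} :
    ξ ∈ box c r ↔ ∀ i, |ξ i - c i| ≤ r i := Iff.rfl

theorem volume_real_box (c : RSpace d) {r : Fin d → ℝ} (hr : ∀ i, 0 ≤ r i) :
    volume.real (box c r : Set (RSpace d)) = ∏ i, (2 * r i) := by
  have h : (box c r : Set (RSpace d)) = (MeasurableEquiv.toLp 2 (Fin d → ℝ)).symm ⁻¹'
      Icc (fun i => c i - r i) (fun i => c i + r i) := by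
    ext ξ
    simp only [mem_preimage, mem_Icc, Pi.le_def, ← forall_and]
    refine forall_congr' fun i => ?_
    rw [abs_le]
    change _ ↔ c i - r i ≤ ξ i ∧ ξ i ≤ c i + r i
    constructor <;> intro h <;> constructor <;> linarith [h.1, h.2]
  rw [measureReal_def, h, (EuclideanSpace.volume_preserving_symm_measurableEquiv_toLp
    (Fin d)).measure_preimage measurableSet_Icc.nullMeasurableSet,
    Real.volume_Icc_pi_toReal (fun i => by linarith [hr i])]
  exact Finset.prod_congr rfl fun i _ => by ring

theorem add_mem_box {c c' : RSpace d} {r : Fin d → ℝ} {ξ ξ' : RSpace d} (h : ξ ∈ box c r)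
    (h' : ξ' ∈ box c' r) : ξ + ξ' ∈ box (c + c') (fun i => 2 * r i) := by
  intro i
  have e : (ξ + ξ') i - (c + c') i = (ξ i - c i) + (ξ' i - c' i) := by
    simp only [PiLp.add_apply]; ring
  rw [e]
  refine (abs_add_le _ _).trans ?_
  linarith [h i, h' i]

theorem norm_le_sum_abs (ξ : RSpace d) : ‖ξ‖ ≤ ∑ i, |ξ i| := by
  have h : ξ = ∑ i, EuclideanSpace.single i (ξ i) := by
    ext j
    simp [Finset.sum_apply]
  conv_lhs => rw [h]
  refine (norm_sum_le _ _).trans (le_of_eq ?_)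
  simp

theorem norm_sub_le_of_mem_box {c : RSpace d} {r : Fin d → ℝ} {ξ : RSpace d} (h : ξ ∈ box c r) :
    ‖ξ - c‖ ≤ ∑ i, r i :=
  (norm_le_sum_abs _).trans (Finset.sum_le_sum fun i _ => h i)

/-! ### Examples: waves concentrated on boxes -/

/-- The dispersion relation `σ|ξ|²` of the Schrödinger equation. -/
def schrodingerDispersion (σ : ℝ) : C(RSpace d, ℝ) := ⟨fun ξ => σ * ‖ξ‖ ^ 2, by fun_prop⟩

theorem freeSchrodinger_packet (σ : ℝ) (S : Compacts (RSpace d)) :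
    freeSchrodinger σ (packet 1 S) = wave (schrodingerDispersion σ) S := by
  funext t
  refine fourierMultiplier_packet _ _ _ _ S fun ξ _ => ?_
  simp only [ContinuousMap.one_apply, mul_one, phaseFactor, schrodingerDispersion,
    ContinuousMap.coe_mk]
  congr 3
  ring

theorem smul_packet (c : ℂ) (m : C(RSpace d, ℂ)) (S : Compacts (RSpace d)) :
    c • packet m S = packet (c • m) S := by
  apply (Lp.fourierTransformₗᵢ (RSpace d) ℂ).injective
  rw [map_smul]
  refine Lp.ext ?_
  have h1 := fourier_packet_ae m S
  have h2 := fourier_packet_ae (c • m) S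
  filter_upwards [Lp.coeFn_smul c (𝓕 (packet m S) : L2Space d), h1, h2] with ζ h0 h1 h2
  refine h0.trans (Eq.trans ?_ h2.symm)
  rw [Pi.smul_apply, h1]
  by_cases hS : (2 * Real.pi) • ζ ∈ (S : Set (RSpace d)) <;> simp [hS]

theorem Cutoff.proj_smul_wave_eq_self (η : Cutoff) {N : ℕ} (c : ℂ) (p : C(RSpace d, ℝ))
    (S : Compacts (RSpace d)) (t : ℝ) (h : ∀ ξ ∈ S, η.psi N ξ = 1) :
    η.proj N (c • wave p S t) = c • wave p S t := by
  rw [wave, smul_packet]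
  exact fourierMultiplier_packet _ _ _ _ S fun ξ hξ => by simp [h ξ hξ]

theorem Cutoff.proj_smul_wave_eq_zero (η : Cutoff) {N : ℕ} (c : ℂ) (p : C(RSpace d, ℝ))
    (S : Compacts (RSpace d)) (t : ℝ) (h : ∀ ξ ∈ S, η.psi N ξ = 0) :
    η.proj N (c • wave p S t) = 0 := by
  rw [wave, smul_packet, ← packet_zero S]
  exact fourierMultiplier_packet _ _ _ _ S fun ξ hξ => by simp [h ξ hξ]

theorem Cutoff.psi_eq_one (η : Cutoff) {k : ℕ} {ξ : RSpace d} (h1 : 5 / 6 * 2 ^ k < ‖ξ‖)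
    (h2 : ‖ξ‖ < 4 / 3 * 2 ^ k) : η.psi (2 ^ k) ξ = 1 := by
  have h0 : (0 : ℝ) < 2 ^ k := by positivity
  unfold Cutoff.psi
  split_ifs with h
  · rw [η.eq_one]
    rw [abs_of_nonneg (norm_nonneg _)]
    have : (2 : ℝ) ^ k = 1 := by exact_mod_cast h
    rw [this] at h2; linarith
  · push_cast
    rw [η.eq_one, η.eq_zero, sub_zero]
    · rw [abs_of_nonneg (by positivity), lt_div_iff₀ h0]; linarith
    · rw [abs_of_nonneg (by positivity), div_le_iff₀ h0]; linarith

theorem Cutoff.psi_eq_zero (η : Cutoff) {j k : ℕ} (hjk : j ≠ k) {ξ : RSpace d}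
    (h1 : 5 / 6 * 2 ^ k < ‖ξ‖) (h2 : ‖ξ‖ < 4 / 3 * 2 ^ k) : η.psi (2 ^ j) ξ = 0 := by
  have h0 : (0 : ℝ) < 2 ^ j := by positivity
  rcases lt_or_gt_of_ne hjk with h | h
  · have h3 : (2 : ℝ) * 2 ^ j ≤ 2 ^ k := by
      rw [← pow_succ']; exact pow_le_pow_right₀ (by norm_num) h
    unfold Cutoff.psi
    split_ifs with hj
    · rw [η.eq_zero]
      have : (2 : ℝ) ^ j = 1 := by exact_mod_cast hj
      rw [abs_of_nonneg (norm_nonneg _)]; linarith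
    · push_cast
      rw [η.eq_zero, η.eq_zero, sub_zero]
      · rw [abs_of_nonneg (by positivity), lt_div_iff₀ h0]; linarith
      · rw [abs_of_nonneg (by positivity), lt_div_iff₀ h0]; linarith
  · have h3 : (2 : ℝ) * 2 ^ k ≤ 2 ^ j := by
      rw [← pow_succ']; exact pow_le_pow_right₀ (by norm_num) h
    have hj : (2 : ℕ) ^ j ≠ 1 := (Nat.one_lt_two_pow (by omega)).ne'
    unfold Cutoff.psi
    rw [if_neg hj]
    push_cast
    rw [η.eq_one, η.eq_one, sub_self]
    · rw [abs_of_nonneg (by positivity), div_le_iff₀ h0]; linarith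
    · rw [abs_of_nonneg (by positivity), div_le_iff₀ h0]; linarith

theorem Cutoff.normF_le (η : Cutoff) {N : ℕ} {σ T : ℝ} {u v : ℝ → L2Space d}
    (hv : η.MemFGlobal N σ T v) (huv : EqOn v u (Icc 0 T)) :
    η.normF N σ T u ≤ η.normFGlobal N σ T v :=
  iInf₂_le v ⟨hv, huv⟩

theorem Cutoff.normF_zero (η : Cutoff) {N : ℕ} (hN : 1 ≤ N) (σ : ℝ) {T : ℝ} (hT : 0 < T)
    (hT1 : T ≤ 1) : η.normF N σ T (fun _ => (0 : L2Space d)) = 0 := by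
  set p : C(RSpace d, ℝ) := schrodingerDispersion σ
  have h := η.memFGlobal_wave σ p ⊥ hN hT hT1 le_rfl (by simp)
  have h0 : ∀ t, wave p ⊥ t = 0 := by
    intro t
    have := η.proj_smul_wave_eq_zero (N := 1) 1 p ⊥ t (fun ξ hξ => (Set.notMem_empty ξ hξ).elim)
    have h2 := η.proj_smul_wave_eq_self (N := 1) 1 p ⊥ t (fun ξ hξ => (Set.notMem_empty ξ hξ).elim)
    rw [this, one_smul] at h2
    exact h2.symm
  obtain ⟨K, -, hK⟩ := exists_normFGlobal_wave_le η
  have h1 := hK d σ p ⊥ N T 1 0 hN hT hT1 le_rfl le_rfl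
    (fun ξ hξ => (Set.notMem_empty ξ hξ).elim)
  refine le_antisymm ((η.normF_le h fun t _ => by simp [h0]).trans (h1.trans ?_)) zero_le
  simp

theorem Cutoff.memFZero_of_proj (η : Cutoff) {k : ℕ} {σ T : ℝ} (hT : 0 < T) (hT1 : T ≤ 1)
    {u : ℝ → L2Space d} (hu : η.MemF (2 ^ k) σ T u) (h1 : ∀ t, η.proj (2 ^ k) (u t) = u t)
    (h0 : ∀ j, j ≠ k → ∀ t, η.proj (2 ^ j) (u t) = 0) : η.MemFZero σ T u := by
  refine ⟨hu.1, ?_⟩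
  rw [tsum_eq_single k]
  · simp_rw [h1]
    exact ENNReal.pow_lt_top hu.2
  · intro j hj
    simp_rw [h0 j hj]
    rw [η.normF_zero Nat.one_le_two_pow σ hT hT1]
    simp

/-- Three waves concentrated on boxes, whose interaction is nearly resonant, violate every trilinear
estimate with too small a constant. -/
theorem exists_box_waves_trilinear (η : Cutoff) (d : ℕ) {T : ℝ} (hT : 0 < T) (hT1 : T ≤ 1)
    (α β : ℝ) : ∃ κ : ℝ, 0 < κ ∧ ∀ (N₁ N₂ N₃ : ℕ) (c₂ c₃ : RSpace d) (r : Fin d → ℝ)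
      (p : C(RSpace d, ℝ)) (l ρ : ℝ) (v : ℝ → L2Space d),
      1 ≤ N₁ → 1 ≤ N₂ → 1 ≤ N₃ → (∀ i, 0 < r i) → 1 ≤ l →
      l * T ≤ (max N₁ (max N₂ N₃) : ℕ) → 0 ≤ ρ →
      (∀ ξ ∈ box c₂ r, |p ξ - β * ‖ξ‖ ^ 2| ≤ ρ * max (N₂ / T) l) →
      (box (c₂ + c₃) (fun i => 2 * r i) : Set (RSpace d)) ⊆ dyadicRegion d N₁ →
      (box c₂ r : Set (RSpace d)) ⊆ dyadicRegion d N₂ →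
      (box c₃ r : Set (RSpace d)) ⊆ dyadicRegion d N₃ →
      (∀ ξ ∈ box c₂ r, ∀ ξ' ∈ box c₃ r, |α * ‖ξ + ξ'‖ ^ 2 - p ξ - α * ‖ξ'‖ ^ 2| ≤
        (max N₁ (max N₂ N₃) : ℕ)) →
      EqOn (fun t => (η.toFun (l * t) : ℂ) • wave p (box c₂ r) t) v (Icc 0 T) →
      η.MemF N₁ α T (wave (schrodingerDispersion α) (box (c₂ + c₃) fun i => 2 * r i)) ∧
      η.MemF N₂ β T v ∧ η.MemF N₃ α T (wave (schrodingerDispersion α) (box c₃ r)) ∧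
      ∀ B : ℝ, 0 ≤ B → B * √(1 + ρ) < κ * √(∏ i, (2 * r i)) →
        B * ((max N₁ (max N₂ N₃) : ℕ) : ℝ)⁻¹ *
          (η.normF N₁ α T
            (wave (schrodingerDispersion α) (box (c₂ + c₃) fun i => 2 * r i))).toReal *
          (η.normF N₂ β T v).toReal *
          (η.normF N₃ α T (wave (schrodingerDispersion α) (box c₃ r))).toReal <
        trilinearIntegral T (max N₁ (max N₂ N₃))
          (wave (schrodingerDispersion α) (box (c₂ + c₃) fun i => 2 * r i)) v
          (wave (schrodingerDispersion α) (box c₃ r)) := by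
  obtain ⟨K, hK, hnorm⟩ := exists_normFGlobal_wave_le η
  refine ⟨T / 2 * ((2 * Real.pi) ^ d)⁻¹ ^ 2 / (K ^ 3 * √(2 ^ d)), by positivity, ?_⟩
  intro N₁ N₂ N₃ c₂ c₃ r p l ρ v hN₁ hN₂ hN₃ hr hl hlT hρ hp hS₁ hS₂ hS₃ hΦ hv
  set M := max N₁ (max N₂ N₃)
  have hM : 1 ≤ M := hN₁.trans (le_max_left _ _)
  have hM' : (1 : ℝ) ≤ M := by exact_mod_cast hM
  have hM0 : (0 : ℝ) < M := by linarith
  set V := ∏ i, (2 * r i)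
  have hV : 0 < V := Finset.prod_pos fun i _ => by linarith [hr i]
  have hV₁ : volume.real (box (c₂ + c₃) (fun i => 2 * r i) : Set (RSpace d)) = 2 ^ d * V := by
    rw [volume_real_box _ fun i => by linarith [hr i], Finset.prod_mul_distrib]
    simp [V]
  have hV₂ : volume.real (box c₂ r : Set (RSpace d)) = V := volume_real_box _ fun i => (hr i).le
  have hV₃ : volume.real (box c₃ r : Set (RSpace d)) = V := volume_real_box _ fun i => (hr i).le
  set A : C(RSpace d, ℝ) := schrodingerDispersion α
  have hfree : ∀ S : Compacts (RSpace d),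
      EqOn (fun t => (η.toFun (1 * t) : ℂ) • wave A S t) (wave A S) (Icc 0 T) := by
    intro S t ht
    simp only [one_mul]
    rw [η.eq_one, Complex.ofReal_one, one_smul]
    rw [abs_of_nonneg ht.1]; linarith [ht.2]
  have hfreenorm : ∀ (N : ℕ) (S : Compacts (RSpace d)), 1 ≤ N →
      (S : Set (RSpace d)) ⊆ dyadicRegion d N →
      η.normF N α T (wave A S) ≤ ENNReal.ofReal (K * √(volume.real (S : Set (RSpace d)))) := by
    intro N S hN hS
    refine (η.normF_le (η.memFGlobal_wave α A S hN hT hT1 le_rfl hS) (hfree S)).trans ?_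
    refine (hnorm d α A S N T 1 0 hN hT hT1 le_rfl le_rfl fun ξ _ => ?_).trans ?_
    · simp [A, schrodingerDispersion]
    · simp
  have hn₁ := hfreenorm N₁ _ hN₁ hS₁
  have hn₃ := hfreenorm N₃ _ hN₃ hS₃
  have hmv := η.memFGlobal_wave β p (box c₂ r) hN₂ hT hT1 hl hS₂
  have hn₂ : η.normF N₂ β T v ≤ ENNReal.ofReal (K * √(1 + ρ) * √V) := by
    refine (η.normF_le hmv hv).trans ?_
    have hmax : 0 < max (N₂ / T) l := lt_of_lt_of_le (by linarith) (le_max_right _ _)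
    refine (hnorm d β p (box c₂ r) N₂ T l (ρ * max (N₂ / T) l) hN₂ hT hT1 hl
      (by positivity) hp).trans (le_of_eq ?_)
    rw [mul_div_cancel_right₀ _ hmax.ne', hV₂]
  rw [hV₁] at hn₁
  rw [hV₃] at hn₃
  have hlow : T / M / 2 * (((2 * Real.pi) ^ d)⁻¹ ^ 2 * V * V) ≤
      trilinearIntegral T M (wave A (box (c₂ + c₃) fun i => 2 * r i)) v
        (wave A (box c₃ r)) := by
    have := trilinearIntegral_wave_ge A p A (box (c₂ + c₃) fun i => 2 * r i) (box c₂ r) (box c₃ r)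
      (fun ξ hξ ξ' hξ' => add_mem_box hξ hξ') hT.le (M := M) (L := M)
      (by rw [div_mul_cancel₀ _ hM0.ne']; exact hT1) hΦ
      (u := wave A (box (c₂ + c₃) fun i => 2 * r i)) (v := v) (w := wave A (box c₃ r))
      (fun _ _ => rfl) (fun t ht => ?_) (fun _ _ => rfl)
    · rwa [hV₂, hV₃] at this
    · have htT : t ≤ T := ht.2.trans (div_le_self hT.le hM')
      rw [← hv ⟨ht.1, htT⟩]
      simp only
      rw [η.eq_one, Complex.ofReal_one, one_smul]
      rw [abs_of_nonneg (mul_nonneg (by linarith) ht.1)]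
      have : l * t ≤ l * (T / M) := mul_le_mul_of_nonneg_left ht.2 (by linarith)
      have h2 : l * (T / M) ≤ 1 := by
        rw [← mul_div_assoc, div_le_one hM0]; exact hlT
      linarith
  refine ⟨⟨(continuous_wave _ _).continuousOn, hn₁.trans_lt ENNReal.ofReal_lt_top⟩,
    ⟨hmv.continuous.continuousOn.congr fun t ht => (hv ht).symm,
      hn₂.trans_lt ENNReal.ofReal_lt_top⟩,
    ⟨(continuous_wave _ _).continuousOn, hn₃.trans_lt ENNReal.ofReal_lt_top⟩, ?_⟩
  intro B hB hBρ
  have t₁ := ENNReal.toReal_le_of_le_ofReal (by positivity) hn₁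
  have t₂ := ENNReal.toReal_le_of_le_ofReal (by positivity) hn₂
  have t₃ := ENNReal.toReal_le_of_le_ofReal (by positivity) hn₃
  refine lt_of_lt_of_le ?_ hlow
  calc _ ≤ B * (M : ℝ)⁻¹ * (K * √(2 ^ d * V)) * (K * √(1 + ρ) * √V) * (K * √V) := by gcongr
    _ = (B * √(1 + ρ)) * ((M : ℝ)⁻¹ * K ^ 3 * √(2 ^ d) * √V * (√V * √V)) := by
        rw [Real.sqrt_mul (by positivity)]; ring
    _ < (T / 2 * ((2 * Real.pi) ^ d)⁻¹ ^ 2 / (K ^ 3 * √(2 ^ d)) * √V) *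
          ((M : ℝ)⁻¹ * K ^ 3 * √(2 ^ d) * √V * (√V * √V)) := by
        gcongr
    _ = T / 2 * ((2 * Real.pi) ^ d)⁻¹ ^ 2 * (M : ℝ)⁻¹ * (√V * √V) * (√V * √V) := by
        field_simp
    _ = _ := by
        rw [Real.mul_self_sqrt hV.le]; ring

theorem exists_lt_two_pow_rpow {e : ℝ} (he : 0 < e) (X : ℝ) :
    ∃ k : ℕ, X < ((2 : ℝ) ^ k) ^ e := by
  have h : Tendsto (fun k : ℕ => ((2 : ℝ) ^ k) ^ e) atTop atTop :=
    (tendsto_rpow_atTop he).comp (tendsto_pow_atTop_atTop_of_one_lt one_lt_two)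
  exact (h.eventually_gt_atTop X).exists

theorem subset_dyadicRegion {k : ℕ} (S : Compacts (RSpace d))
    (h : ∀ ξ ∈ S, 1 / 2 * 2 ^ k ≤ ‖ξ‖ ∧ ‖ξ‖ ≤ 2 * 2 ^ k) :
    (S : Set (RSpace d)) ⊆ dyadicRegion d (2 ^ k) := by
  intro ξ hξ
  obtain ⟨h1, h2⟩ := h ξ hξ
  unfold dyadicRegion
  split_ifs with hk
  · have : (2 : ℝ) ^ k = 1 := by exact_mod_cast hk
    rw [this] at h2
    simpa using h2
  · refine ⟨?_, ?_⟩ <;> push_cast <;> linarith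

/-- Boxes of side `≲ n` around a low frequency `c₂`, `|c₂| = n`, and a high frequency `c₃`,
`|c₃| = N`, lie well inside the corresponding dyadic annuli. -/
theorem norm_bounds_of_mem_box {c₂ c₃ : RSpace d} {r : Fin d → ℝ} {n N : ℝ} (hn : 0 < n)
    (h₂ : ‖c₂‖ = n) (h₃ : ‖c₃‖ = N) (hr : ∑ i, r i ≤ n / 20) (hN : 8 * n ≤ N) :
    (∀ ξ ∈ box (c₂ + c₃) (fun i => 2 * r i), 5 / 6 * N < ‖ξ‖ ∧ ‖ξ‖ < 4 / 3 * N) ∧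
    (∀ ξ ∈ box c₂ r, 5 / 6 * n < ‖ξ‖ ∧ ‖ξ‖ < 4 / 3 * n) ∧
    (∀ ξ ∈ box c₃ r, 5 / 6 * N < ‖ξ‖ ∧ ‖ξ‖ < 4 / 3 * N) := by
  have key : ∀ ξ c : RSpace d, ∀ x y : ℝ, ‖c‖ = x → ‖ξ - c‖ ≤ y →
      x - y ≤ ‖ξ‖ ∧ ‖ξ‖ ≤ x + y := by
    intro ξ c x y hx hy
    have := abs_le.1 (abs_norm_sub_norm_le ξ c)
    constructor <;> linarith [this.1, this.2]
  refine ⟨fun ξ hξ => ?_, fun ξ hξ => ?_, fun ξ hξ => ?_⟩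
  · have h := norm_sub_le_of_mem_box hξ
    rw [← Finset.mul_sum] at h
    have e : ξ - c₃ = (ξ - (c₂ + c₃)) + c₂ := by abel
    have h' : ‖ξ - c₃‖ ≤ n / 10 + n := by
      rw [e]
      refine (norm_add_le _ _).trans ?_
      linarith
    have := key ξ c₃ _ _ h₃ h'
    constructor <;> linarith [this.1, this.2]
  · have := key ξ c₂ _ _ h₂ ((norm_sub_le_of_mem_box hξ).trans hr)
    constructor <;> linarith [this.1, this.2]
  · have := key ξ c₃ _ _ h₃ ((norm_sub_le_of_mem_box hξ).trans hr)
    constructor <;> linarith [this.1, this.2]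

/-- The resonance function of a low-high interaction. -/
theorem norm_add_sq_resonance (α x : ℝ) (ξ ξ' : RSpace d) :
    α * ‖ξ + ξ'‖ ^ 2 - x - α * ‖ξ'‖ ^ 2 = α * ‖ξ‖ ^ 2 + 2 * α * inner ℝ ξ ξ' - x := by
  rw [norm_add_sq_real]; ring

theorem inner_single_right (ξ : RSpace d) (i : Fin d) (a : ℝ) :
    inner ℝ ξ (EuclideanSpace.single i a) = a * ξ i := by
  simp [EuclideanSpace.inner_single_right]

theorem exists_high_frequency (n Q : ℝ) : ∃ m : ℕ, Q ≤ 2 ^ m ∧ 8 * n ≤ 2 ^ m := by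
  obtain ⟨m, hm⟩ := pow_unbounded_of_one_lt (max Q (8 * n)) (one_lt_two : (1 : ℝ) < 2)
  exact ⟨m, (le_max_left _ _).trans hm.le, (le_max_right _ _).trans hm.le⟩

/-- The transported low frequency wave: its interaction with two free waves is resonant in every
dimension. -/
theorem exists_transported_example (η : Cutoff) (d : ℕ) (hd : 1 ≤ d) (α β s : ℝ)
    (hs : s < ((d : ℝ) - 1) / 2) {T : ℝ} (hT : 0 < T) (hT1 : T ≤ 1) (C : ℝ) (hC : 0 < C) :
    ∃ N₁ N₂ N₃ : ℕ, IsDyadic N₁ ∧ IsDyadic N₂ ∧ IsDyadic N₃ ∧ ∃ u v w : ℝ → L2Space d,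
      (η.MemF N₁ α T u ∧ η.MemF N₂ β T v ∧ η.MemF N₃ α T w) ∧
      (η.MemFZero α T u ∧ η.MemFZero β T v ∧ η.MemFZero α T w) ∧
      ((∀ t, η.proj N₁ (u t) = u t) ∧ (∀ t, η.proj N₂ (v t) = v t) ∧
        (∀ t, η.proj N₃ (w t) = w t)) ∧
      C * ((max N₁ (max N₂ N₃) : ℕ) : ℝ)⁻¹ * ((min N₁ (min N₂ N₃) : ℕ) : ℝ) ^ s *
          (η.normF N₁ α T u).toReal * (η.normF N₂ β T v).toReal * (η.normF N₃ α T w).toReal <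
        trilinearIntegral T (max N₁ (max N₂ N₃)) u v w := by
  obtain ⟨κ, hκ, hbox⟩ := exists_box_waves_trilinear η d hT hT1 α β
  have hd' : (1 : ℝ) ≤ d := by exact_mod_cast hd
  set δ : ℝ := 1 / (20 * d)
  have hδ : 0 < δ := by positivity
  set c₁ : ℝ := 1 + 4 * |α| + 4 * |β|
  have hc₁ : 1 ≤ c₁ := by
    have := abs_nonneg α; have := abs_nonneg β
    simp only [c₁]; linarith
  obtain ⟨k, hk⟩ := exists_lt_two_pow_rpow (e := ((d : ℝ) - 1) / 2 - s) (by linarith)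
    (C * √c₁ / (κ * √((2 * δ) ^ d)))
  set n : ℝ := 2 ^ k
  have hn0 : 0 < n := by positivity
  have hn1 : 1 ≤ n := one_le_pow₀ (by norm_num)
  obtain ⟨m, hm1, hm2⟩ := exists_high_frequency n (8 * |α| * n ^ 2)
  set N : ℝ := 2 ^ m
  have hN1 : 1 ≤ N := one_le_pow₀ (by norm_num)
  have hkm : 2 ^ k ≤ 2 ^ m := by
    have : (2 : ℝ) ^ k ≤ 2 ^ m := (by linarith : n ≤ N)
    exact_mod_cast this
  have hmax : max (2 ^ m) (max (2 ^ k) (2 ^ m)) = 2 ^ m := by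
    rw [max_eq_right hkm, max_self]
  have hmin : min (2 ^ m) (min (2 ^ k) (2 ^ m)) = 2 ^ k := by
    rw [min_eq_left hkm, min_eq_right hkm]
  set i₀ : Fin d := ⟨0, hd⟩
  set c₂ : RSpace d := EuclideanSpace.single i₀ n
  set c₃ : RSpace d := EuclideanSpace.single i₀ N
  set r : Fin d → ℝ := fun _ => δ * n
  have hc₂ : ‖c₂‖ = n := by simp [c₂, n]
  have hc₃ : ‖c₃‖ = N := by simp [c₃, N]
  have hrs : ∑ i, r i ≤ n / 20 := by
    simp only [r, Finset.sum_const, Finset.card_univ, Fintype.card_fin, nsmul_eq_mul, δ]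
    refine le_of_eq ?_
    field_simp
  obtain ⟨hB₁, hB₂, hB₃⟩ := norm_bounds_of_mem_box hn0 hc₂ hc₃ hrs hm2
  set p : C(RSpace d, ℝ) := ⟨fun ξ => 2 * α * N * ξ i₀, by fun_prop⟩
  set l : ℝ := N / T
  have hNl : N ≤ l := by
    rw [le_div_iff₀ hT]; nlinarith
  have hl : 1 ≤ l := hN1.trans hNl
  set v : ℝ → L2Space d := fun t => (η.toFun (l * t) : ℂ) • wave p (box c₂ r) t
  have hcoord : ∀ (ξ : RSpace d), |ξ i₀| ≤ ‖ξ‖ := fun ξ => PiLp.norm_apply_le ξ i₀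
  have hreg : ∀ (j : ℕ) (S : Compacts (RSpace d)),
      (∀ ξ ∈ S, 5 / 6 * 2 ^ j < ‖ξ‖ ∧ ‖ξ‖ < 4 / 3 * 2 ^ j) →
      (S : Set (RSpace d)) ⊆ dyadicRegion d (2 ^ j) := by
    intro j S h
    have : (0 : ℝ) < 2 ^ j := by positivity
    refine subset_dyadicRegion S fun ξ hξ => ⟨?_, ?_⟩ <;> linarith [(h ξ hξ).1, (h ξ hξ).2]
  have hΦ : ∀ ξ ∈ box c₂ r, ∀ ξ' ∈ box c₃ r, |α * ‖ξ + ξ'‖ ^ 2 - p ξ - α * ‖ξ'‖ ^ 2| ≤ N := by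
    intro ξ hξ ξ' hξ'
    rw [norm_add_sq_resonance]
    have e : α * ‖ξ‖ ^ 2 + 2 * α * inner ℝ ξ ξ' - p ξ =
        α * (‖ξ‖ ^ 2 + 2 * inner ℝ ξ (ξ' - c₃)) := by
      rw [inner_sub_right, inner_single_right]
      simp only [p, ContinuousMap.coe_mk]; ring
    have h1 : |inner ℝ ξ (ξ' - c₃)| ≤ 2 * n * n :=
      (abs_real_inner_le_norm _ _).trans (by
        gcongr
        · linarith [(hB₂ ξ hξ).2]
        · linarith [norm_sub_le_of_mem_box hξ'])
    have h2 : ‖ξ‖ ^ 2 ≤ (2 * n) ^ 2 := by gcongr; linarith [(hB₂ ξ hξ).2]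
    rw [e, abs_mul]
    calc |α| * |‖ξ‖ ^ 2 + 2 * inner ℝ ξ (ξ' - c₃)| ≤ |α| * (8 * n ^ 2) := by
          gcongr
          refine (abs_add_le _ _).trans ?_
          rw [abs_mul, abs_of_nonneg (sq_nonneg ‖ξ‖), abs_two]
          linarith
      _ ≤ N := by linarith
  have hmod : ∀ ξ ∈ box c₂ r, |p ξ - β * ‖ξ‖ ^ 2| ≤
      ((4 * |α| + 4 * |β|) * n) * max ((2 ^ k : ℕ) / T) l := by
    intro ξ hξ
    have h0 : ‖ξ‖ ≤ 2 * n := by linarith [(hB₂ ξ hξ).2]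
    have h1 : |p ξ| ≤ 4 * |α| * n * N := by
      simp only [p, ContinuousMap.coe_mk]
      rw [abs_mul, abs_mul, abs_mul, abs_two, abs_of_pos (by linarith : 0 < N)]
      calc 2 * |α| * N * |ξ i₀| ≤ 2 * |α| * N * (2 * n) := by
            gcongr
            exact (hcoord ξ).trans h0
        _ = _ := by ring
    have h2 : |β * ‖ξ‖ ^ 2| ≤ 4 * |β| * n * N := by
      rw [abs_mul, abs_of_nonneg (sq_nonneg ‖ξ‖)]
      calc |β| * ‖ξ‖ ^ 2 ≤ |β| * (2 * n) ^ 2 := by gcongr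
        _ = 4 * |β| * n * n := by ring
        _ ≤ _ := by gcongr; linarith
    calc |p ξ - β * ‖ξ‖ ^ 2| ≤ |p ξ| + |β * ‖ξ‖ ^ 2| := abs_sub _ _
      _ ≤ ((4 * |α| + 4 * |β|) * n) * N := by linarith
      _ ≤ _ := by
        gcongr
        exact hNl.trans (le_max_right _ _)
  obtain ⟨m₁, m₂, m₃, hmain⟩ := hbox (2 ^ m) (2 ^ k) (2 ^ m) c₂ c₃ r p l
    ((4 * |α| + 4 * |β|) * n) v Nat.one_le_two_pow Nat.one_le_two_pow Nat.one_le_two_pow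
    (fun _ => by positivity) hl (by
      rw [hmax]; push_cast; exact (div_mul_cancel₀ _ hT.ne').le)
    (by positivity) hmod (hreg m _ hB₁) (hreg k _ hB₂) (hreg m _ hB₃)
    (by rw [hmax]; push_cast; exact hΦ) (fun _ _ => rfl)
  have hproj : ∀ (j : ℕ) (S : Compacts (RSpace d)) (q : C(RSpace d, ℝ)) (a : ℝ → ℂ),
      (∀ ξ ∈ S, 5 / 6 * 2 ^ j < ‖ξ‖ ∧ ‖ξ‖ < 4 / 3 * 2 ^ j) →
      (∀ t, η.proj (2 ^ j) (a t • wave q S t) = a t • wave q S t) ∧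
      (∀ i, i ≠ j → ∀ t, η.proj (2 ^ i) (a t • wave q S t) = 0) := by
    intro j S q a h
    refine ⟨fun t => η.proj_smul_wave_eq_self _ _ _ _ fun ξ hξ =>
      η.psi_eq_one (h ξ hξ).1 (h ξ hξ).2, fun i hi t => η.proj_smul_wave_eq_zero _ _ _ _ fun ξ hξ =>
      η.psi_eq_zero hi (h ξ hξ).1 (h ξ hξ).2⟩
  obtain ⟨a₁, b₁⟩ := hproj m _ (schrodingerDispersion α) (fun _ => 1) hB₁
  obtain ⟨a₂, b₂⟩ := hproj k _ p (fun t => (η.toFun (l * t) : ℂ)) hB₂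
  obtain ⟨a₃, b₃⟩ := hproj m _ (schrodingerDispersion α) (fun _ => 1) hB₃
  simp only [one_smul] at a₁ b₁ a₃ b₃
  refine ⟨2 ^ m, 2 ^ k, 2 ^ m, ⟨m, rfl⟩, ⟨k, rfl⟩, ⟨m, rfl⟩, _, v, _, ⟨m₁, m₂, m₃⟩,
    ⟨η.memFZero_of_proj hT hT1 m₁ a₁ b₁, η.memFZero_of_proj hT hT1 m₂ a₂ b₂,
      η.memFZero_of_proj hT hT1 m₃ a₃ b₃⟩, ⟨a₁, a₂, a₃⟩, ?_⟩
  have h := hmain (C * n ^ s) (by positivity) ?_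
  · rw [hmin]
    push_cast at h ⊢
    rwa [mul_right_comm C]
  · simp only [r, Finset.prod_const, Finset.card_univ, Fintype.card_fin]
    have h1 : √(1 + (4 * |α| + 4 * |β|) * n) ≤ √c₁ * √n := by
      rw [← Real.sqrt_mul (by linarith)]
      refine Real.sqrt_le_sqrt ?_
      simp only [c₁]; linarith
    have h2 : √((2 * (δ * n)) ^ d) = √((2 * δ) ^ d) * n ^ ((d : ℝ) / 2) := by
      rw [← mul_assoc, mul_pow, Real.sqrt_mul (by positivity)]
      congr 1
      rw [Real.sqrt_eq_rpow, ← Real.rpow_natCast, ← Real.rpow_mul hn0.le]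
      congr 1; ring
    have h3 : n ^ ((d : ℝ) / 2) = n ^ (((d : ℝ) - 1) / 2 - s) * (n ^ s * √n) := by
      rw [Real.sqrt_eq_rpow, ← Real.rpow_add hn0, ← Real.rpow_add hn0]
      congr 1; ring
    rw [h2, h3]
    rw [div_lt_iff₀ (by positivity)] at hk
    calc C * n ^ s * √(1 + (4 * |α| + 4 * |β|) * n) ≤ C * n ^ s * (√c₁ * √n) := by gcongr
      _ = C * √c₁ * (n ^ s * √n) := by ring
      _ < n ^ (((d : ℝ) - 1) / 2 - s) * (κ * √((2 * δ) ^ d)) * (n ^ s * √n) := by gcongr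
      _ = _ := by ring

/-- Free waves in dimension `d ≥ 2`: the low frequency is nearly orthogonal to the high ones. -/
theorem exists_free_example_of_two_le (η : Cutoff) (d : ℕ) (hd : 2 ≤ d) (α β s : ℝ)
    (hs : s < ((d : ℝ) - 1) / 2) {T : ℝ} (hT : 0 < T) (hT1 : T ≤ 1) (C : ℝ) (hC : 0 < C) :
    ∃ N₁ N₂ N₃ : ℕ, IsDyadic N₁ ∧ IsDyadic N₂ ∧ IsDyadic N₃ ∧ ∃ f₁ f₂ f₃ : L2Space d,
      (η.MemF N₁ α T (freeSchrodinger α f₁) ∧ η.MemF N₂ β T (freeSchrodinger β f₂) ∧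
        η.MemF N₃ α T (freeSchrodinger α f₃)) ∧
      C * ((max N₁ (max N₂ N₃) : ℕ) : ℝ)⁻¹ * ((min N₁ (min N₂ N₃) : ℕ) : ℝ) ^ s *
          (η.normF N₁ α T (freeSchrodinger α f₁)).toReal *
          (η.normF N₂ β T (freeSchrodinger β f₂)).toReal *
          (η.normF N₃ α T (freeSchrodinger α f₃)).toReal <
        trilinearIntegral T (max N₁ (max N₂ N₃)) (freeSchrodinger α f₁) (freeSchrodinger β f₂)
          (freeSchrodinger α f₃) := by
  obtain ⟨κ, hκ, hbox⟩ := exists_box_waves_trilinear η d hT hT1 α β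
  have hd' : (2 : ℝ) ≤ d := by exact_mod_cast hd
  set δ : ℝ := 1 / (20 * d)
  have hδ : 0 < δ := by positivity
  set ε : ℝ := δ / (1 + |α|)
  have hα0 := abs_nonneg α
  have hε : 0 < ε := by positivity
  have hεδ : ε ≤ δ := div_le_self hδ.le (by linarith)
  have hεα : |α| * ε ≤ 1 / 4 := by
    have h1 : |α| * ε ≤ δ := by
      simp only [ε]
      rw [← mul_div_assoc, div_le_iff₀ (by linarith)]
      nlinarith
    have h2 : δ ≤ 1 / 4 := by
      simp only [δ]
      exact one_div_le_one_div_of_le (by norm_num) (by linarith)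
    linarith
  obtain ⟨k, hk⟩ := exists_lt_two_pow_rpow (e := ((d : ℝ) - 1) / 2 - s) (by linarith)
    (C / (κ * √(2 * ε * (2 * δ) ^ (d - 1))))
  set n : ℝ := 2 ^ k
  have hn0 : 0 < n := by positivity
  have hn1 : 1 ≤ n := one_le_pow₀ (by norm_num)
  obtain ⟨m, hm1, hm2⟩ := exists_high_frequency n (8 * (|α - β| + |α|) * n ^ 2)
  set N : ℝ := 2 ^ m
  have hN1 : 1 ≤ N := one_le_pow₀ (by norm_num)
  have hkm : 2 ^ k ≤ 2 ^ m := by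
    have : (2 : ℝ) ^ k ≤ 2 ^ m := (by linarith : n ≤ N)
    exact_mod_cast this
  have hmax : max (2 ^ m) (max (2 ^ k) (2 ^ m)) = 2 ^ m := by
    rw [max_eq_right hkm, max_self]
  have hmin : min (2 ^ m) (min (2 ^ k) (2 ^ m)) = 2 ^ k := by
    rw [min_eq_left hkm, min_eq_right hkm]
  set i₀ : Fin d := ⟨0, by omega⟩
  set i₁ : Fin d := ⟨1, by omega⟩
  have hi : i₀ ≠ i₁ := by simp [i₀, i₁]
  set c₂ : RSpace d := EuclideanSpace.single i₁ n
  set c₃ : RSpace d := EuclideanSpace.single i₀ N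
  set r : Fin d → ℝ := fun i => if i = i₀ then ε else δ * n
  have hr : ∀ i, 0 < r i := by
    intro i
    simp only [r]
    split_ifs <;> positivity
  have hc₂ : ‖c₂‖ = n := by simp [c₂, n]
  have hc₃ : ‖c₃‖ = N := by simp [c₃, N]
  have hrs : ∑ i, r i ≤ n / 20 := by
    calc ∑ i, r i ≤ ∑ i : Fin d, δ * n := by
          refine Finset.sum_le_sum fun i _ => ?_
          simp only [r]
          split_ifs
          · nlinarith
          · exact le_rfl
      _ = n / 20 := by
          simp only [Finset.sum_const, Finset.card_univ, Fintype.card_fin, nsmul_eq_mul, δ]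
          field_simp
  have hV : ∏ i, (2 * r i) = 2 * ε * (2 * (δ * n)) ^ (d - 1) := by
    have h : ∀ i ∈ Finset.univ.erase i₀, 2 * r i = 2 * (δ * n) := fun i hi => by
      simp only [r]; rw [if_neg (Finset.ne_of_mem_erase hi)]
    rw [← Finset.mul_prod_erase Finset.univ _ (Finset.mem_univ i₀), Finset.prod_congr rfl h]
    simp [r]
  obtain ⟨hB₁, hB₂, hB₃⟩ := norm_bounds_of_mem_box hn0 hc₂ hc₃ hrs hm2
  set p : C(RSpace d, ℝ) := schrodingerDispersion β
  have hreg : ∀ (j : ℕ) (S : Compacts (RSpace d)),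
      (∀ ξ ∈ S, 5 / 6 * 2 ^ j < ‖ξ‖ ∧ ‖ξ‖ < 4 / 3 * 2 ^ j) →
      (S : Set (RSpace d)) ⊆ dyadicRegion d (2 ^ j) := by
    intro j S h
    have : (0 : ℝ) < 2 ^ j := by positivity
    refine subset_dyadicRegion S fun ξ hξ => ⟨?_, ?_⟩ <;> linarith [(h ξ hξ).1, (h ξ hξ).2]
  have hΦ : ∀ ξ ∈ box c₂ r, ∀ ξ' ∈ box c₃ r, |α * ‖ξ + ξ'‖ ^ 2 - p ξ - α * ‖ξ'‖ ^ 2| ≤ N := by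
    intro ξ hξ ξ' hξ'
    rw [norm_add_sq_resonance]
    have e : α * ‖ξ‖ ^ 2 + 2 * α * inner ℝ ξ ξ' - p ξ =
        (α - β) * ‖ξ‖ ^ 2 + (2 * α * inner ℝ ξ (ξ' - c₃) + 2 * N * (α * ξ i₀)) := by
      rw [inner_sub_right, inner_single_right]
      simp only [p, schrodingerDispersion, ContinuousMap.coe_mk]; ring
    have h1 : |inner ℝ ξ (ξ' - c₃)| ≤ 2 * n * n :=
      (abs_real_inner_le_norm _ _).trans (by
        gcongr
        · linarith [(hB₂ ξ hξ).2]
        · linarith [norm_sub_le_of_mem_box hξ'])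
    have h2 : ‖ξ‖ ^ 2 ≤ (2 * n) ^ 2 := by gcongr; linarith [(hB₂ ξ hξ).2]
    have h3 : |ξ i₀| ≤ ε := by
      have := mem_box.1 hξ i₀
      simpa [c₂, r, hi] using this
    have b1 : |(α - β) * ‖ξ‖ ^ 2| ≤ |α - β| * (2 * n) ^ 2 := by
      rw [abs_mul, abs_of_nonneg (sq_nonneg ‖ξ‖)]; gcongr
    have b2 : |2 * α * inner ℝ ξ (ξ' - c₃)| ≤ 2 * |α| * (2 * n * n) := by
      rw [abs_mul, abs_mul, abs_two]; gcongr
    have b3 : |2 * N * (α * ξ i₀)| ≤ 2 * N * (1 / 4) := by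
      rw [abs_mul, abs_of_pos (by linarith : 0 < 2 * N), abs_mul]
      gcongr
      exact le_trans (by gcongr) hεα
    rw [e]
    refine (abs_add_le _ _).trans ?_
    have := abs_add_le (2 * α * inner ℝ ξ (ξ' - c₃)) (2 * N * (α * ξ i₀))
    nlinarith
  obtain ⟨m₁, m₂, m₃, hmain⟩ := hbox (2 ^ m) (2 ^ k) (2 ^ m) c₂ c₃ r p 1 0
    (wave p (box c₂ r)) Nat.one_le_two_pow Nat.one_le_two_pow Nat.one_le_two_pow
    hr le_rfl (by
      rw [hmax]; push_cast; linarith)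
    le_rfl (fun ξ _ => by simp [p, schrodingerDispersion]) (hreg m _ hB₁) (hreg k _ hB₂)
    (hreg m _ hB₃) (by rw [hmax]; push_cast; exact hΦ) (fun t ht => by
      simp only [one_mul]
      rw [η.eq_one, Complex.ofReal_one, one_smul]
      rw [abs_of_nonneg ht.1]; linarith [ht.2])
  refine ⟨2 ^ m, 2 ^ k, 2 ^ m, ⟨m, rfl⟩, ⟨k, rfl⟩, ⟨m, rfl⟩,
    packet 1 (box (c₂ + c₃) fun i => 2 * r i), packet 1 (box c₂ r), packet 1 (box c₃ r), ?_⟩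
  simp only [freeSchrodinger_packet]
  refine ⟨⟨m₁, m₂, m₃⟩, ?_⟩
  have h := hmain (C * n ^ s) (by positivity) ?_
  · rw [hmin]
    push_cast at h ⊢
    rwa [mul_right_comm C]
  · rw [hV, add_zero, Real.sqrt_one, mul_one]
    have h2 : √(2 * ε * (2 * (δ * n)) ^ (d - 1)) =
        √(2 * ε * (2 * δ) ^ (d - 1)) * n ^ (((d : ℝ) - 1) / 2) := by
      rw [← mul_assoc 2 δ, mul_pow, ← mul_assoc, Real.sqrt_mul (by positivity)]
      congr 1
      rw [Real.sqrt_eq_rpow, ← Real.rpow_natCast, ← Real.rpow_mul hn0.le,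
        Nat.cast_sub (by omega)]
      congr 1; push_cast; ring
    have h3 : n ^ (((d : ℝ) - 1) / 2) = n ^ (((d : ℝ) - 1) / 2 - s) * n ^ s := by
      rw [← Real.rpow_add hn0]
      congr 1; ring
    rw [h2, h3]
    rw [div_lt_iff₀ (by positivity)] at hk
    calc C * n ^ s < n ^ (((d : ℝ) - 1) / 2 - s) * (κ * √(2 * ε * (2 * δ) ^ (d - 1))) * n ^ s := by
          gcongr
      _ = _ := by ring

theorem exists_two_pow_near {x : ℝ} (hx : 1 ≤ x) :
    ∃ k : ℕ, 3 / 4 * 2 ^ k ≤ x ∧ x ≤ 3 / 2 * 2 ^ k := by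
  obtain ⟨k, h1, h2⟩ := exists_nat_pow_near (show 1 ≤ 4 / 3 * x by linarith)
    (one_lt_two : (1 : ℝ) < 2)
  rw [pow_succ] at h2
  exact ⟨k, by linarith, by linarith⟩

/-- Free waves in dimension one: if `α ≠ β`, the three frequencies can be chosen comparable and
resonant. -/
theorem exists_free_example_of_one (η : Cutoff) {α β s : ℝ} (hα : α ≠ 0) (hβα : β + α ≠ 0)
    (hαβ : α ≠ β) (hs : s < 0) {T : ℝ} (hT : 0 < T) (hT1 : T ≤ 1) (C : ℝ) (hC : 0 < C) :
    ∃ N₁ N₂ N₃ : ℕ, IsDyadic N₁ ∧ IsDyadic N₂ ∧ IsDyadic N₃ ∧ ∃ f₁ f₂ f₃ : L2Space 1,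
      (η.MemF N₁ α T (freeSchrodinger α f₁) ∧ η.MemF N₂ β T (freeSchrodinger β f₂) ∧
        η.MemF N₃ α T (freeSchrodinger α f₃)) ∧
      C * ((max N₁ (max N₂ N₃) : ℕ) : ℝ)⁻¹ * ((min N₁ (min N₂ N₃) : ℕ) : ℝ) ^ s *
          (η.normF N₁ α T (freeSchrodinger α f₁)).toReal *
          (η.normF N₂ β T (freeSchrodinger β f₂)).toReal *
          (η.normF N₃ α T (freeSchrodinger α f₃)).toReal <
        trilinearIntegral T (max N₁ (max N₂ N₃)) (freeSchrodinger α f₁) (freeSchrodinger β f₂)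
          (freeSchrodinger α f₃) := by
  obtain ⟨κ, hκ, hbox⟩ := exists_box_waves_trilinear η 1 hT hT1 α β
  set θ : ℝ := (β - α) / (2 * α)
  have hθ : 2 * α * θ = β - α := by simp only [θ]; field_simp
  have hθ0 : θ ≠ 0 := div_ne_zero (sub_ne_zero.2 hαβ.symm) (by simpa using hα)
  have hθ1 : 1 + θ ≠ 0 := by
    intro h
    apply hβα
    have : θ = -1 := by linarith
    rw [this] at hθ; linarith
  set D : ℝ := 1 + |α - β| + 2 * |α|
  have hD : 1 ≤ D := by
    have := abs_nonneg (α - β); have := abs_nonneg α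
    simp only [D]; linarith
  set ε : ℝ := 1 / (8 * D)
  have hε : 0 < ε := by positivity
  have hεD : D * ε = 1 / 8 := by simp only [ε]; field_simp
  have hε8 : ε ≤ 1 / 8 := by nlinarith
  set b : ℝ := min 1 (min |θ| |1 + θ|)
  have hb0 : 0 < b := lt_min one_pos (lt_min (abs_pos.2 hθ0) (abs_pos.2 hθ1))
  obtain ⟨k, hk⟩ := exists_lt_two_pow_rpow (e := -s) (by linarith) (C / (κ * √(2 * ε)))
  set y : ℝ := 2 ^ k
  have hy : 1 ≤ y := one_le_pow₀ (by norm_num)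
  set M : ℝ := 3 / 2 * y / b
  have hMb : M * b = 3 / 2 * y := div_mul_cancel₀ _ hb0.ne'
  have hM0 : 0 < M := by positivity
  have x2 : 3 / 2 * y ≤ M := by
    rw [← hMb]; exact mul_le_of_le_one_right hM0.le (min_le_left _ _)
  have x3 : 3 / 2 * y ≤ M * |θ| := by
    rw [← hMb]
    exact mul_le_mul_of_nonneg_left ((min_le_right _ _).trans (min_le_left _ _)) hM0.le
  have x1 : 3 / 2 * y ≤ M * |1 + θ| := by
    rw [← hMb]
    exact mul_le_mul_of_nonneg_left ((min_le_right _ _).trans (min_le_right _ _)) hM0.le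
  obtain ⟨k₁, l₁, u₁⟩ := exists_two_pow_near (show 1 ≤ M * |1 + θ| by linarith)
  obtain ⟨k₂, l₂, u₂⟩ := exists_two_pow_near (show 1 ≤ M by linarith)
  obtain ⟨k₃, l₃, u₃⟩ := exists_two_pow_near (show 1 ≤ M * |θ| by linarith)
  set c₂ : RSpace 1 := EuclideanSpace.single 0 M
  set c₃ : RSpace 1 := EuclideanSpace.single 0 (θ * M)
  set r : Fin 1 → ℝ := fun _ => ε
  have hnorm : ∀ ξ : RSpace 1, ‖ξ‖ = |ξ 0| := by
    intro ξ; simp [EuclideanSpace.norm_eq, Real.sqrt_sq_eq_abs]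
  have hc₂ : ‖c₂‖ = M := by simp [c₂, abs_of_pos hM0]
  have hc₃ : ‖c₃‖ = M * |θ| := by simp [c₃, abs_of_pos hM0, mul_comm]
  have hc₁ : ‖c₂ + c₃‖ = M * |1 + θ| := by
    have e : (c₂ + c₃) 0 = M * (1 + θ) := by simp [c₂, c₃]; ring
    rw [hnorm, e, abs_mul, abs_of_pos hM0]
  have hreg : ∀ (j : ℕ) (c : RSpace 1) (r : Fin 1 → ℝ), r 0 ≤ 1 / 4 → 3 / 4 * 2 ^ j ≤ ‖c‖ →
      ‖c‖ ≤ 3 / 2 * 2 ^ j → (box c r : Set (RSpace 1)) ⊆ dyadicRegion 1 (2 ^ j) := by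
    intro j c r hr h1 h2
    have hj : (1 : ℝ) ≤ 2 ^ j := one_le_pow₀ (by norm_num)
    refine subset_dyadicRegion _ fun ξ hξ => ?_
    have h := norm_sub_le_of_mem_box hξ
    simp only [Fin.sum_univ_one, Fin.isValue] at h
    have := abs_le.1 ((abs_norm_sub_norm_le ξ c).trans h)
    constructor <;> linarith [this.1, this.2]
  set p : C(RSpace 1, ℝ) := schrodingerDispersion β
  have hMmax : 2 / 3 * M ≤ ((max (2 ^ k₁) (max (2 ^ k₂) (2 ^ k₃)) : ℕ) : ℝ) := by
    have : ((2 ^ k₂ : ℕ) : ℝ) ≤ ((max (2 ^ k₁) (max (2 ^ k₂) (2 ^ k₃)) : ℕ) : ℝ) := by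
      exact_mod_cast (le_max_left _ _).trans (le_max_right _ _)
    push_cast at this ⊢
    linarith
  have hymin : y ≤ ((min (2 ^ k₁) (min (2 ^ k₂) (2 ^ k₃)) : ℕ) : ℝ) := by
    push_cast
    refine le_min ?_ (le_min ?_ ?_) <;> linarith
  obtain ⟨m₁, m₂, m₃, hmain⟩ := hbox (2 ^ k₁) (2 ^ k₂) (2 ^ k₃) c₂ c₃ r p 1 0
    (wave p (box c₂ r)) Nat.one_le_two_pow Nat.one_le_two_pow Nat.one_le_two_pow
    (fun _ => hε) le_rfl (by linarith)
    le_rfl (fun ξ _ => by simp [p, schrodingerDispersion])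
    (hreg k₁ _ _ (by simp only [r]; linarith) (by rwa [hc₁]) (by rwa [hc₁]))
    (hreg k₂ _ _ (by simp only [r]; linarith) (by rwa [hc₂]) (by rwa [hc₂]))
    (hreg k₃ _ _ (by simp only [r]; linarith) (by rwa [hc₃]) (by rwa [hc₃]))
    (fun ξ hξ ξ' hξ' => by
      refine le_trans ?_ hMmax
      have h2 : |ξ 0 - M| ≤ ε := by simpa [c₂, r] using mem_box.1 hξ 0
      have h3 : |ξ' 0 - θ * M| ≤ ε := by simpa [c₃, r] using mem_box.1 hξ' 0
      have e : α * ‖ξ + ξ'‖ ^ 2 - p ξ - α * ‖ξ'‖ ^ 2 =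
          ξ 0 * ((α - β) * (ξ 0 - M) + 2 * α * (ξ' 0 - θ * M)) := by
        simp only [p, schrodingerDispersion, ContinuousMap.coe_mk, hnorm, sq_abs, PiLp.add_apply]
        linear_combination (M * ξ 0) * hθ
      rw [e, abs_mul]
      have h4 : |ξ 0| ≤ 2 * M := by
        have := abs_le.1 h2
        exact abs_le.2 ⟨by linarith [this.1], by linarith [this.2]⟩
      have h5 : |(α - β) * (ξ 0 - M) + 2 * α * (ξ' 0 - θ * M)| ≤ D * ε := by
        refine (abs_add_le _ _).trans ?_
        rw [abs_mul, abs_mul, abs_mul, abs_two]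
        calc |α - β| * |ξ 0 - M| + 2 * |α| * |ξ' 0 - θ * M| ≤ |α - β| * ε + 2 * |α| * ε := by
              gcongr
          _ ≤ D * ε := by simp only [D]; nlinarith
      calc |ξ 0| * |(α - β) * (ξ 0 - M) + 2 * α * (ξ' 0 - θ * M)| ≤ 2 * M * (D * ε) := by gcongr
        _ ≤ _ := by rw [hεD]; linarith)
    (fun t ht => by
      simp only [one_mul]
      rw [η.eq_one, Complex.ofReal_one, one_smul]
      rw [abs_of_nonneg ht.1]; linarith [ht.2])
  refine ⟨2 ^ k₁, 2 ^ k₂, 2 ^ k₃, ⟨k₁, rfl⟩, ⟨k₂, rfl⟩, ⟨k₃, rfl⟩,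
    packet 1 (box (c₂ + c₃) fun i => 2 * r i), packet 1 (box c₂ r), packet 1 (box c₃ r), ?_⟩
  simp only [freeSchrodinger_packet]
  refine ⟨⟨m₁, m₂, m₃⟩, ?_⟩
  have h := hmain (C * ((min (2 ^ k₁) (min (2 ^ k₂) (2 ^ k₃)) : ℕ) : ℝ) ^ s) (by positivity) ?_
  · rwa [mul_right_comm C]
  · simp only [r, Finset.univ_unique, Finset.prod_const, Finset.card_singleton, pow_one, add_zero,
      Real.sqrt_one, mul_one]
    rw [div_lt_iff₀ (by positivity), Real.rpow_neg (by linarith)] at hk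
    have hys : 0 < y ^ s := by positivity
    calc _ ≤ C * y ^ s := by
          gcongr ?_ * ?_
          exact Real.rpow_le_rpow_of_nonpos (by linarith) hymin hs.le
      _ < (y ^ s)⁻¹ * (κ * √(2 * ε)) * y ^ s := by gcongr
      _ = _ := by field_simp

end

theorem mainTheorem8 (η : Cutoff) (d : ℕ) (hd : 1 ≤ d) (α β γ : ℝ)
    (hα : α ≠ 0) (hβ : β ≠ 0) (hγ : γ ≠ 0) (hαγ : α - γ = 0) (hβγ : β + γ ≠ 0)
    (s : ℝ) (hs : s < ((d : ℝ) - 1) / 2) (T : ℝ) (hT : T ∈ Set.Ioc (0 : ℝ) 1) :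
    (∀ C : ℝ, 0 < C →
      ∃ N₁ N₂ N₃ : ℕ, IsDyadic N₁ ∧ IsDyadic N₂ ∧ IsDyadic N₃ ∧
      ∃ u v w : ℝ → L2Space d,
        η.MemF N₁ α T u ∧ η.MemF N₂ β T v ∧ η.MemF N₃ γ T w ∧
        ((2 ≤ d ∨ α ≠ β) →
          ∃ f₁ f₂ f₃ : L2Space d, u = freeSchrodinger α f₁ ∧ v = freeSchrodinger β f₂ ∧
            w = freeSchrodinger γ f₃) ∧
        C * ((max N₁ (max N₂ N₃) : ℕ) : ℝ)⁻¹ * ((min N₁ (min N₂ N₃) : ℕ) : ℝ) ^ s *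
            (η.normF N₁ α T u).toReal * (η.normF N₂ β T v).toReal *
            (η.normF N₃ γ T w).toReal
          < trilinearIntegral T (max N₁ (max N₂ N₃)) u v w) ∧
    ¬ ∃ A : ℝ, ∀ N₁ N₂ N₃ : ℕ, IsDyadic N₁ → IsDyadic N₂ → IsDyadic N₃ →
      ∀ u v w : ℝ → L2Space d, η.MemFZero α T u → η.MemFZero β T v → η.MemFZero γ T w →
        trilinearIntegral T (max N₁ (max N₂ N₃)) (fun t => η.proj N₁ (u t))
            (fun t => η.proj N₂ (v t)) (fun t => η.proj N₃ (w t))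
          ≤ A * ((max N₁ (max N₂ N₃) : ℕ) : ℝ)⁻¹ * ((min N₁ (min N₂ N₃) : ℕ) : ℝ) ^ s *
              (η.normF N₁ α T fun t => η.proj N₁ (u t)).toReal *
              (η.normF N₂ β T fun t => η.proj N₂ (v t)).toReal *
              (η.normF N₃ γ T fun t => η.proj N₃ (w t)).toReal := by
  obtain ⟨hT0, hT1⟩ := hT
  obtain rfl : α = γ := sub_eq_zero.1 hαγ
  refine ⟨fun C hC => ?_, ?_⟩
  · by_cases h : 2 ≤ d ∨ α ≠ β
    · have hfree : ∃ N₁ N₂ N₃ : ℕ, IsDyadic N₁ ∧ IsDyadic N₂ ∧ IsDyadic N₃ ∧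
          ∃ f₁ f₂ f₃ : L2Space d,
          (η.MemF N₁ α T (freeSchrodinger α f₁) ∧ η.MemF N₂ β T (freeSchrodinger β f₂) ∧
            η.MemF N₃ α T (freeSchrodinger α f₃)) ∧
          C * ((max N₁ (max N₂ N₃) : ℕ) : ℝ)⁻¹ * ((min N₁ (min N₂ N₃) : ℕ) : ℝ) ^ s *
              (η.normF N₁ α T (freeSchrodinger α f₁)).toReal *
              (η.normF N₂ β T (freeSchrodinger β f₂)).toReal *
              (η.normF N₃ α T (freeSchrodinger α f₃)).toReal <
            trilinearIntegral T (max N₁ (max N₂ N₃)) (freeSchrodinger α f₁)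
              (freeSchrodinger β f₂) (freeSchrodinger α f₃) := by
        by_cases h2 : 2 ≤ d
        · exact exists_free_example_of_two_le η d h2 α β s hs hT0 hT1 C hC
        · obtain rfl : d = 1 := by omega
          exact exists_free_example_of_one η hα hβγ (h.resolve_left h2) (by simpa using hs)
            hT0 hT1 C hC
      obtain ⟨N₁, N₂, N₃, d₁, d₂, d₃, f₁, f₂, f₃, ⟨m₁, m₂, m₃⟩, hlt⟩ := hfree
      exact ⟨N₁, N₂, N₃, d₁, d₂, d₃, _, _, _, m₁, m₂, m₃,
        fun _ => ⟨f₁, f₂, f₃, rfl, rfl, rfl⟩, hlt⟩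
    · obtain ⟨N₁, N₂, N₃, d₁, d₂, d₃, u, v, w, ⟨m₁, m₂, m₃⟩, -, -, hlt⟩ :=
        exists_transported_example η d hd α β s hs hT0 hT1 C hC
      exact ⟨N₁, N₂, N₃, d₁, d₂, d₃, u, v, w, m₁, m₂, m₃, fun h' => absurd h' h, hlt⟩
  · rintro ⟨A, hA⟩
    obtain ⟨N₁, N₂, N₃, d₁, d₂, d₃, u, v, w, -, ⟨z₁, z₂, z₃⟩, ⟨p₁, p₂, p₃⟩, hlt⟩ :=
      exists_transported_example η d hd α β s hs hT0 hT1 (max A 1) (by positivity)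
    have h := hA N₁ N₂ N₃ d₁ d₂ d₃ u v w z₁ z₂ z₃
    simp only [p₁, p₂, p₃] at h
    refine absurd (hlt.trans_le h) (not_lt.2 ?_)
    gcongr
    exact le_max_left _ _
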